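/- Let $\omega>0$, $T=\frac{2\pi}{\omega}$, let $g\in L^\infty(\mathbb R)$ be real-valued and even with $g\not\equiv 0$, and let $\gamma\in\mathbb R\setminus\{0\}$. Write $\mathbb Z_{odd}=2\mathbb Z+1$ and let $\mathbb N_{odd}$ be the set of odd positive integers. For $k\in\mathbb N_{odd}$ let $L_k=-\frac{d^2}{dx^2}-k^2\omega^2g$, a self-adjoint operator in $L^2(\mathbb R)$ with domain $H^2(\mathbb R)$; let $\sigma_{ess}(L_k)$ be its essential spectrum, and let $\sigma_D(L_k)$ be the spectrum of $L_k$ with an extra Dirichlet condition at $0$, i.e. of the restriction of $L_k$ to odd functions. Assume: (C1) $0\notin\sigma_{ess}(L_k)\cup\sigma_D(L_k)$ for all $k\in\mathbb N_{odd}$. (Then for each $k\in\mathbb N_{odd}$ there is a unique real-valued $\Phi_k\in H^2(0,\infty)$ with $L_k\Phi_k=0$ on $(0,\infty)$ and $\Phi_k(0)=1$; put $\Phi_{-k}=\Phi_k$.) (C2) There are $\rho,M>0$ such that $|\Phi_k(x)|\le Me^{-\rho x}$ for all $x\ge 0$ and all $k\in\mathbb N_{odd}$. Assume moreover that either $\gamma<0$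 and $\Phi_k'(0)>0$ for some $k\in\mathbb N_{odd}$, or $\gamma>0$ and $\Phi_k'(0)<0$ for some $k\in\mathbb N_{odd}$. Sequences indexed by $\mathbb Z_{odd}$ are extended by zero to $\mathbb Z$, and $(z*y)_k=\sum_{l\in\mathbb Z}z_ly_{k-l}$. Let $$\mathrm{Dom}(J)=\{z\in\mathbb R^{\mathbb Z_{odd}}:\ z_k=-z_{-k},\ |||z|||<\infty\},\qquad |||z|||=\|z*z\|_{\ell^2}^{1/2},$$ $$J(z)=\frac14(z*z*z*z)_0+\frac{T}{\gamma\omega^4}\sum_{k\in\mathbb Z_{odd}}\frac{\Phi_k'(0)}{k^2}z_k^2\qquad(z\in\mathrm{Dom}(J)),$$ where $z*z*z*z$ is formed as $(z*z)*(z*z)$, and for $N\in\mathbb N_{odd}$ let $\mathrm{Dom}(J^{(N)})=\{z\in\mathrm{Dom}(J):\ z_k=0\text{ for all }|k|>N\}$ and $J^{(N)}=J|_{\mathrm{Dom}(J^{(N)})}$. Then $\inf J>-\infty$, and the following holds. (i) For every sufficiently large $N\in\mathbb N_{odd}$ there is $\alpha^{(N)}\in\mathrm{Dom}(J^{(N)})$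 with $J(\alpha^{(N)})=\min J^{(N)}<0$; and for every choice of such minimizers $\alpha^{(N)}$ of $J^{(N)}$, $\lim_{N\to\infty}J(\alpha^{(N)})=\inf J$. (ii) For every such choice of minimizers there are a strictly increasing sequence $(N_n)_n$ in $\mathbb N_{odd}$ and $\alpha\in\mathrm{Dom}(J)$ such that $|||\alpha^{(N_n)}-\alpha|||\to 0$ as $n\to\infty$ and $J(\alpha)=\inf J$. -/

import Mathlib

open MeasureTheory Filter Topology
open scoped ENNReal

noncomputable section

namespace Breather

/-! ## Unbounded operators and their spectra

An unbounded operator `A` in a normed space `E` is represented by its graph, a linear subspace of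
`E × E`: the relation `(u, f) ∈ A` reads `u ∈ D(A)` and `A u = f`. -/

section Spectrum

variable {E : Type*} [NormedAddCommGroup E] [NormedSpace ℂ E]

/-- The resolvent set: `A - μ` has an everywhere defined bounded two-sided inverse `R`. -/
def resolventSet (A : Submodule ℂ (E × E)) : Set ℂ :=
  {μ | ∃ R : E →L[ℂ] E, (∀ h : E, (R h, h + μ • R h) ∈ A) ∧
    ∀ u f : E, (u, f) ∈ A → R (f - μ • u) = u}

/-- The spectrum `σ(A)`. -/
def spectrum (A : Submodule ℂ (E × E)) : Set ℂ := (resolventSet A)ᶜ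

/-- The eigenspace `ker (A - μ)`. -/
def eigenspace (A : Submodule ℂ (E × E)) (μ : ℂ) : Submodule ℂ E :=
  A.comap (LinearMap.prod LinearMap.id (μ • LinearMap.id))

/-- The discrete spectrum: isolated points of the spectrum that are eigenvalues of finite
multiplicity. -/
def discreteSpectrum (A : Submodule ℂ (E × E)) : Set ℂ :=
  {μ | μ ∈ spectrum A ∧ (∃ ε > 0, ∀ ν ∈ spectrum A, dist ν μ < ε → ν = μ) ∧
    eigenspace A μ ≠ ⊥ ∧ FiniteDimensional ℂ (eigenspace A μ)}

/-- The essential spectrum `σ_ess(A)` (of a self-adjoint operator). -/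
def essentialSpectrum (A : Submodule ℂ (E × E)) : Set ℂ := spectrum A \ discreteSpectrum A

end Spectrum

/-! ## Sobolev functions of one variable and the operators `L_k` -/

/-- `φ ∈ H²(I)` (for `I = ℝ` or a half-line), where `φ` is the continuously differentiable
representative, `φ₁` its first derivative on `I`, and `φ₂` its second weak derivative: `φ₁` is
locally absolutely continuous with density `φ₂`, and `φ`, `φ₁`, `φ₂` are square integrable. -/
structure IsH2 {F : Type*} [NormedAddCommGroup F] [NormedSpace ℝ F]
    (I : Set ℝ) (φ φ₁ φ₂ : ℝ → F) : Prop where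
  memLp : MemLp φ 2 (volume.restrict I)
  memLp_deriv : MemLp φ₁ 2 (volume.restrict I)
  memLp_deriv2 : MemLp φ₂ 2 (volume.restrict I)
  hasDeriv : ∀ x ∈ I, HasDerivWithinAt φ (φ₁ x) I x
  deriv_sub : ∀ x ∈ I, ∀ y ∈ I, φ₁ y - φ₁ x = ∫ t in x..y, φ₂ t

/-- The complex Hilbert space `L²(ℝ)`. -/
abbrev L2 : Type := Lp ℂ 2 (volume : Measure ℝ)

theorem intervalIntegrable_of_memLp {φ : ℝ → ℂ} (h : MemLp φ 2 (volume.restrict Set.univ))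
    (x y : ℝ) : IntervalIntegrable φ volume x y := by
  rw [Measure.restrict_univ] at h
  have h' : LocallyIntegrable φ volume := h.locallyIntegrable (by norm_num)
  exact (h'.integrableOn_isCompact isCompact_uIcc).intervalIntegrable

/-- The (graph of the) operator `L_k = -d²/dx² - k² ω² g` in `L²(ℝ)` with domain `H²(ℝ)`. -/
def opL (g : ℝ → ℝ) (ω : ℝ) (k : ℕ) : Submodule ℂ (L2 × L2) where
  carrier := {p | ∃ φ φ₁ φ₂ : ℝ → ℂ, IsH2 Set.univ φ φ₁ φ₂ ∧ p.1 =ᵐ[volume] φ ∧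
    ∀ᵐ x, p.2 x = -φ₂ x - ((k ^ 2 * ω ^ 2 * g x : ℝ) : ℂ) * φ x}
  zero_mem' := by
    refine ⟨0, 0, 0, ⟨?_, ?_, ?_, ?_, ?_⟩, Lp.coeFn_zero _ _ _, ?_⟩
    · exact MemLp.zero
    · exact MemLp.zero
    · exact MemLp.zero
    · intro x _; exact hasDerivWithinAt_const x _ (0 : ℂ)
    · intro x _ y _; simp
    · filter_upwards [Lp.coeFn_zero ℂ 2 (volume : Measure ℝ)] with x hx
      simp
  add_mem' := by
    rintro ⟨u, f⟩ ⟨v, h⟩ ⟨φ, φ₁, φ₂, hφ, hu, hf⟩ ⟨ψ, ψ₁, ψ₂, hψ, hv, hh⟩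
    refine ⟨φ + ψ, φ₁ + ψ₁, φ₂ + ψ₂, ⟨hφ.memLp.add hψ.memLp, hφ.memLp_deriv.add hψ.memLp_deriv,
      hφ.memLp_deriv2.add hψ.memLp_deriv2, ?_, ?_⟩, ?_, ?_⟩
    · intro x hx; exact (hφ.hasDeriv x hx).add (hψ.hasDeriv x hx)
    · intro x hx y hy
      have := intervalIntegral.integral_add (intervalIntegrable_of_memLp hφ.memLp_deriv2 x y)
        (intervalIntegrable_of_memLp hψ.memLp_deriv2 x y)
      simp only [Pi.add_apply]
      rw [this, ← hφ.deriv_sub x hx y hy, ← hψ.deriv_sub x hx y hy]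
      ring
    · exact (Lp.coeFn_add u v).trans (hu.add hv)
    · filter_upwards [Lp.coeFn_add f h, hf, hh] with x h1 h2 h3
      simp only [Prod.mk_add_mk, h1, Pi.add_apply]
      change f x = _ at h2
      change h x = _ at h3
      rw [h2, h3]; ring
  smul_mem' := by
    rintro c ⟨u, f⟩ ⟨φ, φ₁, φ₂, hφ, hu, hf⟩
    refine ⟨c • φ, c • φ₁, c • φ₂, ⟨hφ.memLp.const_smul c, hφ.memLp_deriv.const_smul c,
      hφ.memLp_deriv2.const_smul c, ?_, ?_⟩, ?_, ?_⟩
    · intro x hx; exact (hφ.hasDeriv x hx).const_smul c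
    · intro x hx y hy
      simp only [Pi.smul_apply, intervalIntegral.integral_smul, ← hφ.deriv_sub x hx y hy, smul_sub]
    · exact (Lp.coeFn_smul c u).trans (hu.const_smul c)
    · filter_upwards [Lp.coeFn_smul c f, hf] with x h1 h2
      simp only [Prod.smul_mk, h1, Pi.smul_apply, smul_eq_mul]
      change f x = _ at h2
      rw [h2]; ring

/-- The closed subspace of odd functions in `L²(ℝ)`. -/
def oddL2 : Submodule ℂ L2 where
  carrier := {u | ∀ᵐ x : ℝ, u (-x) = -u x}
  zero_mem' := by
    have h := Lp.coeFn_zero ℂ 2 (volume : Measure ℝ)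
    have h' := (Measure.measurePreserving_neg (volume : Measure ℝ)).quasiMeasurePreserving.ae h
    change ∀ᵐ x : ℝ, (0 : L2) (-x) = -(0 : L2) x
    filter_upwards [h, h'] with x h1 h2
    rw [h1, h2]; simp
  add_mem' := by
    intro u v hu hv
    have h := Lp.coeFn_add u v
    have h' := (Measure.measurePreserving_neg (volume : Measure ℝ)).quasiMeasurePreserving.ae h
    change ∀ᵐ x : ℝ, (u + v : L2) (-x) = -(u + v : L2) x
    filter_upwards [h, h', hu, hv] with x h1 h2 h3 h4
    rw [h1, h2]
    simp only [Pi.add_apply, h3, h4]; ring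
  smul_mem' := by
    intro c u hu
    have h := Lp.coeFn_smul c u
    have h' := (Measure.measurePreserving_neg (volume : Measure ℝ)).quasiMeasurePreserving.ae h
    change ∀ᵐ x : ℝ, (c • u : L2) (-x) = -(c • u : L2) x
    filter_upwards [h, h', hu] with x h1 h2 h3
    rw [h1, h2]
    simp [h3]

/-- `L_k` with an extra Dirichlet condition at `0`, realized as the restriction of `L_k` to odd
functions: an operator in `oddL2` with domain the odd functions of `H²(ℝ)`. -/
def opLDirichlet (g : ℝ → ℝ) (ω : ℝ) (k : ℕ) : Submodule ℂ (oddL2 × oddL2) :=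
  (opL g ω k).comap (LinearMap.prodMap oddL2.subtype oddL2.subtype)

/-! ## The conditions on the potential -/

/-- `g ∈ L^∞(ℝ)` is even, `g ≢ 0`, and `γ ≠ 0`. -/
structure CondC0 (g : ℝ → ℝ) (γ : ℝ) : Prop where
  bounded : MemLp g ∞ volume
  even : ∀ᵐ x : ℝ, g (-x) = g x
  nontrivial : ¬ ∀ᵐ x : ℝ, g x = 0
  gamma_ne : γ ≠ 0

/-- For every odd `k ≥ 1`, the point `0` lies neither in the essential spectrum nor in the
Dirichlet spectrum of `L_k`. -/
def CondC1 (g : ℝ → ℝ) (ω : ℝ) : Prop :=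
  ∀ k : ℕ, Odd k → (0 : ℂ) ∉ essentialSpectrum (opL g ω k) ∪ spectrum (opLDirichlet g ω k)

/-- `φ ∈ H²(0,∞)`, `L_k φ = 0` on `(0,∞)` and `φ(0) = 1`. -/
def IsDecayingSolution (g : ℝ → ℝ) (ω : ℝ) (k : ℕ) (φ : ℝ → ℝ) : Prop :=
  ∃ φ₁ φ₂ : ℝ → ℝ, IsH2 (Set.Ici 0) φ φ₁ φ₂ ∧
    (∀ᵐ x ∂volume.restrict (Set.Ioi 0), -φ₂ x - k ^ 2 * ω ^ 2 * g x * φ x = 0) ∧ φ 0 = 1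

/-- The decaying fundamental solution `Φ_k`. Under the conditions `CondC0` and `CondC1` it exists;
its values on `[0,∞)`, the only ones that are used, are then uniquely determined. -/
def Phi (g : ℝ → ℝ) (ω : ℝ) (k : ℕ) : ℝ → ℝ :=
  Classical.epsilon (IsDecayingSolution g ω k)

/-- The one-sided derivative `Φ_k'(0)`. -/
def PhiDeriv (g : ℝ → ℝ) (ω : ℝ) (k : ℕ) : ℝ := derivWithin (Phi g ω k) (Set.Ici 0) 0

/-- The uniform exponential bound for the decaying fundamental solutions. -/
def CondC2 (g : ℝ → ℝ) (ω : ℝ) : Prop :=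
  ∃ ρ > 0, ∃ M > 0, ∀ k : ℕ, Odd k → ∀ x : ℝ, 0 ≤ x → |Phi g ω k x| ≤ M * Real.exp (-ρ * x)

/-! ## The sequence space and the functional

A sequence indexed by the odd integers is represented by its extension by zero to `ℤ`. -/

/-- Convolution of two real sequences. -/
def conv (z y : ℤ → ℝ) (k : ℤ) : ℝ := ∑' l : ℤ, z l * y (k - l)

open Classical in
/-- `‖z * z‖_{ℓ²}^{1/2}`, which is `∞` if the convolution `z * z` is not defined. -/
def tripleNorm (z : ℤ → ℝ) : ℝ≥0∞ :=
  if ∀ k : ℤ, Summable fun l : ℤ => z l * z (k - l) then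
    (∑' k : ℤ, ENNReal.ofReal (conv z z k ^ 2)) ^ (1 / 4 : ℝ)
  else ∞

/-- `Dom(J)`: odd real sequences, supported on the odd integers, with `‖z * z‖_{ℓ²} < ∞`. -/
def DomJ : Set (ℤ → ℝ) :=
  {z | (∀ k : ℤ, Even k → z k = 0) ∧ (∀ k : ℤ, z k = -z (-k)) ∧ tripleNorm z < ∞}

/-- `J(z) = (1/4) (z * z * z * z)_0 + T / (γ ω⁴) ∑_k (Φ_k'(0) / k²) z_k²` with `T = 2π/ω` and
`Φ_k = Φ_{|k|}`. The fourfold convolution is formed as `(z * z) * (z * z)`, which converges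
absolutely on `Dom(J)`; the terms with even `k` vanish. -/
def J (g : ℝ → ℝ) (ω γ : ℝ) (z : ℤ → ℝ) : ℝ :=
  1 / 4 * conv (conv z z) (conv z z) 0 +
    (2 * Real.pi / ω) / (γ * ω ^ 4) * ∑' k : ℤ, PhiDeriv g ω k.natAbs / (k : ℝ) ^ 2 * z k ^ 2

/-- `Dom(J^(N))`: the sequences in `Dom(J)` supported in `|k| ≤ N`. -/
def DomJN (N : ℕ) : Set (ℤ → ℝ) := {z ∈ DomJ | ∀ k : ℤ, (N : ℤ) < |k| → z k = 0}

/-- `a` minimizes the restriction of `J` to `Dom(J^(N))`. -/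
def IsMinimizerN (g : ℝ → ℝ) (ω γ : ℝ) (N : ℕ) (a : ℤ → ℝ) : Prop :=
  a ∈ DomJN N ∧ ∀ z ∈ DomJN N, J g ω γ a ≤ J g ω γ z

end Breather

end

namespace Breather

/-! ## The decaying fundamental solutions -/

/-! For finitely supported `z`, `quartic z` (that is ‖z * z‖²) is the mean over a period of |p|⁴,
where p is the trigonometric polynomial with coefficients `z`. So J is a fourth power of an L⁴ norm
plus a diagonal quadratic form with coefficients c_k, and the direct method applies. Since `z` is
odd, (z * z)_0 = -‖z‖² in ℓ², so the quartic part dominates ‖z‖⁴: J is bounded below and its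
sublevel sets are bounded in ℓ². Condition (C2) and interpolation at scale 1/k give Φ_k'(0) = O(k),
so c_k = O(1/k), and the quadratic part is continuous along ℓ²-bounded, coordinatewise convergent
sequences (`tendsto_lin`).

The quartic part is controlled by Fejér means, which are finitely supported and do not increase it
(`quartic_fejer_le`). They yield lower semicontinuity (`quartic_le_of_tendsto`), Clarkson's
inequality for infinite sequences (`quartic_add_add_quartic_sub_le`), and competitors in Dom(J^(N))
with almost the same energy (`exists_energy_fejer_lt`); hence min J^(N) tends to inf J.

A coordinatewise limit of minimizers then minimizes J. Both the energies and the quadratic parts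
converge, hence so do the quartic parts, and Clarkson's inequality turns this into norm convergence
(`tendsto_tripleNorm_sub`). Negativity of the minima comes from a small two-point sequence, for
which the quadratic term beats the quartic one. -/

theorem memLp_exp_neg_abs : MemLp (fun x : ℝ => Real.exp (-|x|)) 2 volume := by
  rw [memLp_two_iff_integrable_sq (by fun_prop)]
  have h : ∀ x : ℝ, Real.exp (-|x|) ^ 2 = Real.exp (-2 * |x|) := fun x => by
    rw [← Real.exp_nat_mul]; congr 1; push_cast; ring
  simp_rw [h]
  rw [← integrableOn_univ, ← Set.Iic_union_Ioi (a := (0 : ℝ))]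
  refine IntegrableOn.union ?_ ?_
  · refine (integrableOn_exp_mul_Iic (a := 2) (by norm_num) 0).congr_fun (fun x hx => ?_)
      measurableSet_Iic
    simp [abs_of_nonpos (Set.mem_Iic.1 hx)]
  · refine (integrableOn_exp_mul_Ioi (a := -2) (by norm_num) 0).congr_fun (fun x hx => ?_)
      measurableSet_Ioi
    simp [abs_of_pos (Set.mem_Ioi.1 hx)]

theorem memLp_exp_neg_Ici :
    MemLp (fun x : ℝ => Real.exp (-x)) 2 (volume.restrict (Set.Ici 0)) := by
  refine (memLp_congr_ae ?_).1 (memLp_exp_neg_abs.restrict (Set.Ici 0))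
  filter_upwards [ae_restrict_mem measurableSet_Ici] with x hx
  rw [abs_of_nonneg (Set.mem_Ici.1 hx)]

/-- The odd right-hand side whose Dirichlet solution corrects `exp (-x)` to a solution. -/
noncomputable def oddSource (q : ℝ → ℝ) (x : ℝ) : ℝ := (SignType.sign x : ℝ) * (1 + q x) * Real.exp (-|x|)

theorem memLp_oddSource {q : ℝ → ℝ} (hq : MemLp q ∞ volume) :
    MemLp (fun x => (oddSource q x : ℂ)) 2 volume := by
  have hs : MemLp (fun x : ℝ => (SignType.sign x : ℝ)) ∞ volume := by
    refine memLp_top_of_bound ?_ 1 (ae_of_all _ fun x => ?_)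
    · have : (fun x : ℝ => (SignType.sign x : ℝ)) =
          fun x => (if 0 < x then (1 : ℝ) else if x < 0 then -1 else 0) := by
        funext x
        rcases lt_trichotomy x 0 with h | h | h
        · simp [h, h.not_gt]
        · simp [h]
        · simp [h]
      rw [this]
      refine (Measurable.ite measurableSet_Ioi measurable_const
        (Measurable.ite measurableSet_Iio measurable_const
          measurable_const)).aestronglyMeasurable
    · rcases lt_trichotomy x 0 with h | h | h <;> simp [h]
  have h0 : MemLp (fun _ : ℝ => (1 : ℝ)) ∞ volume :=
    memLp_top_of_bound aestronglyMeasurable_const 1 (by simp)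
  have h1 : MemLp (fun x => 1 + q x) ∞ volume := h0.add hq
  have h2 : MemLp (fun x => (SignType.sign x : ℝ) * (1 + q x)) ∞ volume :=
    MemLp.mul' (p := ∞) (q := ∞) h1 hs
  have h3 : MemLp (fun x => (SignType.sign x : ℝ) * (1 + q x) * Real.exp (-|x|)) 2 volume :=
    MemLp.mul' (p := ∞) (q := 2) memLp_exp_neg_abs h2
  exact h3.ofReal

theorem oddSource_neg {q : ℝ → ℝ} {x : ℝ} (hx : q (-x) = q x) :
    oddSource q (-x) = -oddSource q x := by
  simp [oddSource, hx, Left.sign_neg]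

/-- The ansatz is φ = exp(-x) + ψ with ψ odd. On the half-line L_k exp(-x) = -(1 + q) exp(-x) with q
= k²ω²g, so ψ must solve L_k ψ = `oddSource q`; this is possible because 0 lies in the resolvent set
of the Dirichlet operator. As ψ vanishes at 0, φ(0) = 1. -/
theorem exists_isDecayingSolution {g : ℝ → ℝ} {ω : ℝ} (hg : MemLp g ∞ volume)
    (heven : ∀ᵐ x : ℝ, g (-x) = g x) {k : ℕ}
    (h0 : (0 : ℂ) ∉ spectrum (opLDirichlet g ω k)) : ∃ φ, IsDecayingSolution g ω k φ := by
  simp only [spectrum, Set.mem_compl_iff, not_not] at h0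
  obtain ⟨R, hR, -⟩ := h0
  set q : ℝ → ℝ := fun x => k ^ 2 * ω ^ 2 * g x with hq
  have hqL : MemLp q ∞ volume := hg.const_mul _
  have hqe : ∀ᵐ x : ℝ, q (-x) = q x := by
    filter_upwards [heven] with x hx
    simp [hq, hx]
  set hL : L2 := (memLp_oddSource hqL).toLp _ with hhL
  have hLe : ∀ᵐ x, hL x = (oddSource q x : ℂ) := (memLp_oddSource hqL).coeFn_toLp
  have hodd : hL ∈ oddL2 := by
    have h' := (Measure.measurePreserving_neg (volume : Measure ℝ)).quasiMeasurePreserving.ae hLe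
    change ∀ᵐ x : ℝ, hL (-x) = -hL x
    filter_upwards [hLe, h', hqe] with x h1 h2 h3
    rw [h1, h2, oddSource_neg h3]
    simp
  have hmem := hR ⟨hL, hodd⟩
  rw [zero_smul, add_zero] at hmem
  obtain ⟨ψ, ψ₁, ψ₂, hψ, hu, hf⟩ := hmem
  have hcont : Continuous ψ := continuous_iff_continuousAt.2 fun x =>
    ((hasDerivWithinAt_univ.1 (hψ.hasDeriv x trivial))).continuousAt
  -- Membership in `oddL2` is only almost everywhere; continuity of ψ makes oddness hold pointwise,
  -- in particular at 0.
  have hψodd : (fun x => ψ (-x)) = fun x => -ψ x := by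
    have h1 : ∀ᵐ x : ℝ, (R ⟨hL, hodd⟩ : L2) (-x) = -(R ⟨hL, hodd⟩ : L2) x := (R ⟨hL, hodd⟩).2
    have hu' : ∀ᵐ x, (R ⟨hL, hodd⟩ : L2) x = ψ x := hu
    have h' := (Measure.measurePreserving_neg (volume : Measure ℝ)).quasiMeasurePreserving.ae hu'
    refine (Continuous.ae_eq_iff_eq volume (by fun_prop) (by fun_prop)).1 ?_
    filter_upwards [h1, hu', h'] with x h1 h2 h3
    rw [← h3, h1, h2]
  have hψ0 : ψ 0 = 0 := by
    have := congrFun hψodd 0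
    simp only [neg_zero] at this
    exact self_eq_neg.1 this
  have hmu : ∀ {θ : ℝ → ℂ}, MemLp θ 2 (volume.restrict Set.univ) →
      MemLp (fun x => (θ x).re) 2 (volume.restrict (Set.Ici 0)) := fun h => by
    rw [Measure.restrict_univ] at h
    exact h.re.restrict _
  refine ⟨fun x => Real.exp (-x) + (ψ x).re, fun x => -Real.exp (-x) + (ψ₁ x).re,
    fun x => Real.exp (-x) + (ψ₂ x).re,
    ⟨memLp_exp_neg_Ici.add (hmu hψ.memLp), memLp_exp_neg_Ici.neg.add (hmu hψ.memLp_deriv),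
      memLp_exp_neg_Ici.add (hmu hψ.memLp_deriv2), ?_, ?_⟩, ?_, by simp [hψ0]⟩
  · intro x _
    have h1 : HasDerivAt (fun x => (ψ x).re) (ψ₁ x).re x :=
      Complex.reCLM.hasFDerivAt.comp_hasDerivAt x
        (hasDerivWithinAt_univ.1 (hψ.hasDeriv x trivial))
    have h2 : HasDerivAt (fun x : ℝ => Real.exp (-x)) (-Real.exp (-x)) x := by
      simpa using (hasDerivAt_neg x).exp
    exact (h2.add h1).hasDerivWithinAt
  · intro x _ y _
    have hi := intervalIntegrable_of_memLp hψ.memLp_deriv2 x y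
    have h1 : ∫ t in x..y, (ψ₂ t).re = (ψ₁ y).re - (ψ₁ x).re := by
      rw [← Complex.sub_re, hψ.deriv_sub x trivial y trivial]
      exact Complex.reCLM.intervalIntegral_comp_comm hi
    have h2 : ∫ t in x..y, Real.exp (-t) = -Real.exp (-y) - -Real.exp (-x) := by
      refine intervalIntegral.integral_eq_sub_of_hasDerivAt (f := fun t => -Real.exp (-t))
        (fun t _ => ?_) (by apply Continuous.intervalIntegrable; fun_prop)
      have h3 : HasDerivAt (fun x : ℝ => Real.exp (-x)) (-Real.exp (-t)) t := by
        simpa using (hasDerivAt_neg t).exp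
      exact h3.fun_neg.congr_deriv (neg_neg _)
    rw [intervalIntegral.integral_add (by apply Continuous.intervalIntegrable; fun_prop) ?_,
      h1, h2]
    · ring
    · exact ⟨hi.1.re, hi.2.re⟩
  · rw [ae_restrict_iff' measurableSet_Ioi]
    filter_upwards [hLe, hf] with x h1 h2 hx
    change hL x = _ at h2
    rw [h1] at h2
    have h3 := congrArg Complex.re h2
    rw [Complex.ofReal_re, Complex.sub_re, Complex.re_ofReal_mul] at h3
    simp only [oddSource, sign_pos (Set.mem_Ioi.1 hx), abs_of_pos (Set.mem_Ioi.1 hx), hq] at h3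
    simp at h3
    linarith

/-- A solution of `φ'' = -q φ` on the half-line satisfies a Landau-type interpolation bound. -/
theorem abs_deriv_zero_le {φ φ₁ φ₂ : ℝ → ℝ} (hφ : IsH2 (Set.Ici 0) φ φ₁ φ₂) {M Q h : ℝ}
    (hM : ∀ x, 0 ≤ x → |φ x| ≤ M) (hQ : ∀ᵐ x ∂volume.restrict (Set.Ioi 0), |φ₂ x| ≤ Q)
    (hh : 0 < h) (hQ0 : 0 ≤ Q) : h * |φ₁ 0| ≤ 2 * M + Q * h ^ 2 := by
  have h1 : ∀ y ∈ Set.Icc 0 h, |φ₁ y - φ₁ 0| ≤ Q * h := by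
    intro y hy
    rw [hφ.deriv_sub 0 (by simp) y hy.1]
    rw [ae_restrict_iff' measurableSet_Ioi] at hQ
    refine (intervalIntegral.norm_integral_le_of_norm_le_const_ae (f := φ₂) (C := Q) ?_).trans ?_
    · filter_upwards [hQ] with x hx hxy
      rw [Set.uIoc_of_le hy.1] at hxy
      exact hx hxy.1
    · rw [sub_zero, abs_of_nonneg hy.1]
      exact mul_le_mul_of_nonneg_left hy.2 hQ0
  -- The mean value inequality for φ minus its linear part gives |φ(h) - φ(0) - hφ'(0)| ≤ Q h².
  have h2 := (convex_Icc 0 h).norm_image_sub_le_of_norm_hasDerivWithin_le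
    (f := fun x => φ x - x * φ₁ 0) (f' := fun x => φ₁ x - φ₁ 0) (C := Q * h) (x := 0) (y := h)
    (fun x hx => ?_) h1 ⟨le_rfl, hh.le⟩ ⟨hh.le, le_rfl⟩
  · simp only [zero_mul, sub_zero, Real.norm_eq_abs, abs_of_pos hh] at h2
    have h3 : |h * φ₁ 0| ≤ |φ h| + |φ 0| + |φ h - h * φ₁ 0 - φ 0| :=
      calc |h * φ₁ 0| = |φ h - φ 0 - (φ h - h * φ₁ 0 - φ 0)| := by congr 1; ring
        _ ≤ |φ h - φ 0| + |φ h - h * φ₁ 0 - φ 0| := abs_sub _ _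
        _ ≤ _ := by gcongr; exact abs_sub _ _
    rw [abs_mul, abs_of_pos hh] at h3
    have := hM h hh.le
    have := hM 0 le_rfl
    nlinarith
  · have := (hφ.hasDeriv x hx.1).mono (Set.Icc_subset_Ici_self : Set.Icc 0 h ⊆ Set.Ici 0)
    simpa using this.fun_sub ((hasDerivWithinAt_id x _).mul_const (φ₁ 0))

/-- The equation gives Φ_k'' = O(k²) while Φ_k = O(1), both uniformly, so interpolation yields
Φ_k'(0) = O(k). This makes Φ_k'(0)/k² tend to zero. -/
theorem exists_phiDeriv_bound {g : ℝ → ℝ} {ω γ : ℝ} (hC0 : CondC0 g γ) (hC1 : CondC1 g ω)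
    (hC2 : CondC2 g ω) : ∃ C, 0 ≤ C ∧ ∀ k : ℕ, Odd k → |PhiDeriv g ω k| ≤ C * k := by
  obtain ⟨ρ, hρ, M, hM, hb⟩ := hC2
  obtain ⟨G, hG⟩ : ∃ G : ℝ, ∀ᵐ x, |g x| ≤ G := by
    refine ⟨(eLpNormEssSup g volume).toReal, ?_⟩
    have hfin : eLpNormEssSup g volume ≠ ∞ := by
      simpa using hC0.bounded.2.ne
    filter_upwards [enorm_ae_le_eLpNormEssSup g volume] with x hx
    have := ENNReal.toReal_mono hfin hx
    simpa using this
  have hG0 : 0 ≤ G := by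
    obtain ⟨x, hx⟩ := hG.exists
    exact (abs_nonneg _).trans hx
  refine ⟨2 * M + ω ^ 2 * G * M, by positivity, fun k hk => ?_⟩
  have hk0 : (0 : ℝ) < k := by exact_mod_cast hk.pos
  have hsol : IsDecayingSolution g ω k (Phi g ω k) :=
    Classical.epsilon_spec (exists_isDecayingSolution hC0.bounded hC0.even
      fun h => hC1 k hk (Or.inr h))
  obtain ⟨φ₁, φ₂, hφ, hode, -⟩ := hsol
  have hd : PhiDeriv g ω k = φ₁ 0 :=
    (hφ.hasDeriv 0 (by simp)).derivWithin (uniqueDiffOn_Ici 0 0 (by simp))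
  have hb' : ∀ x, 0 ≤ x → |Phi g ω k x| ≤ M := fun x hx =>
    (hb k hk x hx).trans (mul_le_of_le_one_right hM.le (Real.exp_le_one_iff.2 (by nlinarith)))
  have h2 : ∀ᵐ x ∂volume.restrict (Set.Ioi 0), |φ₂ x| ≤ k ^ 2 * ω ^ 2 * G * M := by
    filter_upwards [hode, ae_restrict_of_ae hG, ae_restrict_mem measurableSet_Ioi] with x h1 h3 hx
    have : φ₂ x = -(k ^ 2 * ω ^ 2 * g x * Phi g ω k x) := by linarith
    rw [this, abs_neg, abs_mul, abs_mul, abs_of_nonneg (by positivity : 0 ≤ (k : ℝ) ^ 2 * ω ^ 2)]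
    have := hb' x (Set.mem_Ioi.1 hx).le
    gcongr
  -- The length h = 1/k balances M/h against k²h.
  have h3 := abs_deriv_zero_le hφ hb' h2 (h := (k : ℝ)⁻¹) (by positivity) (by positivity)
  rw [hd]
  calc |φ₁ 0| = k * ((k : ℝ)⁻¹ * |φ₁ 0|) := by field_simp
    _ ≤ k * (2 * M + k ^ 2 * ω ^ 2 * G * M * (k : ℝ)⁻¹ ^ 2) := by gcongr
    _ = (2 * M + ω ^ 2 * G * M) * k := by field_simp

/-! ## Odd square summable sequences and the quartic functional -/

/-- Odd, square summable real sequences. -/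
structure IsOddSq (z : ℤ → ℝ) : Prop where
  odd : ∀ k, z k = -z (-k)
  summable : Summable fun k => z k ^ 2

/-- `‖z * z‖²` in `ℓ²`. -/
noncomputable def quartic (z : ℤ → ℝ) : ℝ≥0∞ := ∑' k : ℤ, ENNReal.ofReal (conv z z k ^ 2)

theorem summable_mul_sub {z y : ℤ → ℝ} (hz : Summable fun k => z k ^ 2)
    (hy : Summable fun k => y k ^ 2) (k : ℤ) : Summable fun l => z l * y (k - l) := by
  have hy' : Summable fun l => y (k - l) ^ 2 := (Equiv.subLeft k).summable_iff.2 hy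
  refine Summable.of_norm_bounded (hz.add hy') fun l => ?_
  rw [Real.norm_eq_abs, abs_mul]
  nlinarith [sq_nonneg (|z l| - |y (k - l)|), sq_abs (z l), sq_abs (y (k - l)),
    sq_nonneg (z l), sq_nonneg (y (k - l))]

theorem IsOddSq.add {a b : ℤ → ℝ} (ha : IsOddSq a) (hb : IsOddSq b) : IsOddSq (a + b) where
  odd k := by simp only [Pi.add_apply, ha.odd k, hb.odd k]; ring
  summable := by
    refine Summable.of_nonneg_of_le (fun _ => sq_nonneg _) (fun k => ?_)
      ((ha.summable.add hb.summable).mul_left 2)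
    simp only [Pi.add_apply]
    nlinarith [sq_nonneg (a k - b k)]

theorem IsOddSq.smul {a : ℤ → ℝ} (ha : IsOddSq a) (c : ℝ) : IsOddSq (c • a) where
  odd k := by simp only [Pi.smul_apply, smul_eq_mul]; rw [ha.odd k]; ring
  summable := by
    simp only [Pi.smul_apply, smul_eq_mul, mul_pow]
    exact ha.summable.mul_left _

theorem IsOddSq.sub {a b : ℤ → ℝ} (ha : IsOddSq a) (hb : IsOddSq b) : IsOddSq (a - b) := by
  have := ha.add (hb.smul (-1))
  rwa [neg_one_smul, ← sub_eq_add_neg] at this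

theorem conv_self_zero {z : ℤ → ℝ} (hz : ∀ k, z k = -z (-k)) : conv z z 0 = -∑' k, z k ^ 2 := by
  rw [conv, ← tsum_neg]
  congr 1
  funext l
  rw [zero_sub, ← neg_eq_iff_eq_neg.2 (hz l)]
  ring

theorem conv_self_neg {z : ℤ → ℝ} (hz : ∀ k, z k = -z (-k)) (k : ℤ) :
    conv z z (-k) = conv z z k := by
  rw [conv, conv, ← (Equiv.neg ℤ).tsum_eq]
  congr 1
  funext l
  rw [Equiv.neg_apply, hz l, hz (k - l)]
  rw [show -k - -l = -(k - l) by ring]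
  ring

theorem conv_smul_self (c : ℝ) (z : ℤ → ℝ) (k : ℤ) :
    conv (c • z) (c • z) k = c ^ 2 * conv z z k := by
  rw [conv, conv, ← tsum_mul_left]
  congr 1
  funext l
  simp only [Pi.smul_apply, smul_eq_mul]
  ring

theorem quartic_smul (c : ℝ) (z : ℤ → ℝ) :
    quartic (c • z) = ENNReal.ofReal (c ^ 4) * quartic z := by
  rw [quartic, quartic, ← ENNReal.tsum_mul_left]
  congr 1
  funext k
  rw [conv_smul_self, ← ENNReal.ofReal_mul (by positivity)]
  congr 1
  ring

/-- Coercivity: by oddness the term k = 0 of the series alone is the fourth power of the ℓ² norm. -/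
theorem sq_tsum_sq_le_quartic {z : ℤ → ℝ} (hz : ∀ k, z k = -z (-k)) :
    ENNReal.ofReal ((∑' k, z k ^ 2) ^ 2) ≤ quartic z := by
  have := ENNReal.le_tsum (f := fun k => ENNReal.ofReal (conv z z k ^ 2)) 0
  rwa [conv_self_zero hz, neg_sq] at this

theorem tripleNorm_eq {z : ℤ → ℝ} (hz : Summable fun k => z k ^ 2) :
    tripleNorm z = quartic z ^ (1 / 4 : ℝ) :=
  if_pos fun k => summable_mul_sub hz hz k

/-- A finite `tripleNorm` requires the series for (z * z)_0 to converge, and for odd `z` this is -∑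
z_k². So square summability is automatic on `DomJ`, and the junk branch of `tripleNorm` plays no
further role. -/
theorem mem_domJ_iff {z : ℤ → ℝ} :
    z ∈ DomJ ↔ (∀ k : ℤ, Even k → z k = 0) ∧ IsOddSq z ∧ quartic z < ∞ := by
  constructor
  · rintro ⟨h1, h2, h3⟩
    have hs : ∀ k : ℤ, Summable fun l : ℤ => z l * z (k - l) := by
      by_contra h
      rw [tripleNorm, if_neg h] at h3
      exact lt_irrefl _ h3
    have hs0 : Summable fun k => z k ^ 2 := by
      refine (hs 0).neg.congr fun l => ?_
      rw [zero_sub, ← neg_eq_iff_eq_neg.2 (h2 l)]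
      ring
    refine ⟨h1, ⟨h2, hs0⟩, ?_⟩
    rw [tripleNorm_eq hs0] at h3
    by_contra h
    rw [not_lt_top_iff.1 h, ENNReal.top_rpow_of_pos (by norm_num)] at h3
    exact lt_irrefl _ h3
  · rintro ⟨h1, h2, h3⟩
    refine ⟨h1, h2.odd, ?_⟩
    rw [tripleNorm_eq h2.summable]
    exact ENNReal.rpow_lt_top_of_nonneg (by norm_num) h3.ne

theorem conv_conv_zero {z : ℤ → ℝ} (hz : ∀ k, z k = -z (-k)) :
    conv (conv z z) (conv z z) 0 = (quartic z).toReal := by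
  rw [conv, quartic, ENNReal.tsum_toReal_eq fun _ => ENNReal.ofReal_ne_top]
  congr 1
  funext k
  rw [zero_sub, conv_self_neg hz, ENNReal.toReal_ofReal (sq_nonneg _), sq]

/-! ## Trigonometric polynomials -/

/-- The trigonometric polynomial with coefficients `a` on `[-n, n]`. -/
noncomputable def trigPoly (n : ℕ) (a : ℤ → ℝ) (t : ℝ) : ℂ :=
  ∑ k ∈ Finset.Icc (-n : ℤ) n, (a k : ℂ) * Complex.exp (k * t * Complex.I)

theorem continuous_trigPoly (n : ℕ) (a : ℤ → ℝ) : Continuous (trigPoly n a) := by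
  unfold trigPoly
  fun_prop

theorem trigPoly_add (n : ℕ) (a b : ℤ → ℝ) (t : ℝ) :
    trigPoly n (a + b) t = trigPoly n a t + trigPoly n b t := by
  simp [trigPoly, add_mul, Finset.sum_add_distrib]

theorem trigPoly_sub (n : ℕ) (a b : ℤ → ℝ) (t : ℝ) :
    trigPoly n (a - b) t = trigPoly n a t - trigPoly n b t := by
  simp [trigPoly, sub_mul, Finset.sum_sub_distrib]

theorem integral_exp_int_mul (k : ℤ) :
    ∫ t in (0 : ℝ)..(2 * Real.pi), Complex.exp (k * t * Complex.I) =
      if k = 0 then (2 * Real.pi : ℂ) else 0 := by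
  split_ifs with h
  · simp [h]
  · have h' : (k : ℂ) * Complex.I ≠ 0 := mul_ne_zero (by exact_mod_cast h) Complex.I_ne_zero
    have : ∀ t : ℝ, (k : ℂ) * t * Complex.I = k * Complex.I * t := fun t => by ring
    simp_rw [this]
    rw [integral_exp_mul_complex h']
    have h2 : (k : ℂ) * Complex.I * ((2 * Real.pi : ℝ) : ℂ) = k * (2 * Real.pi * Complex.I) := by
      push_cast; ring
    rw [h2, Complex.exp_int_mul_two_pi_mul_I]
    simp

theorem integral_norm_trigPoly_sq (n : ℕ) (a : ℤ → ℝ) :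
    ∫ t in (0 : ℝ)..(2 * Real.pi), ‖trigPoly n a t‖ ^ 2 =
      2 * Real.pi * ∑ k ∈ Finset.Icc (-n : ℤ) n, a k ^ 2 := by
  have h1 : ∀ t : ℝ, ((‖trigPoly n a t‖ ^ 2 : ℝ) : ℂ) =
      ∑ k ∈ Finset.Icc (-n : ℤ) n, ∑ l ∈ Finset.Icc (-n : ℤ) n,
        (a k * a l : ℂ) * Complex.exp (((k - l : ℤ) : ℂ) * t * Complex.I) := by
    intro t
    push_cast
    rw [← Complex.mul_conj', trigPoly, map_sum, Finset.sum_mul_sum]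
    refine Finset.sum_congr rfl fun k _ => Finset.sum_congr rfl fun l _ => ?_
    rw [map_mul, ← Complex.exp_conj, Complex.conj_ofReal, mul_mul_mul_comm, ← Complex.exp_add]
    congr 2
    simp
    ring
  have h2 : ((∫ t in (0 : ℝ)..(2 * Real.pi), ‖trigPoly n a t‖ ^ 2 : ℝ) : ℂ) =
      ((2 * Real.pi * ∑ k ∈ Finset.Icc (-n : ℤ) n, a k ^ 2 : ℝ) : ℂ) := by
    rw [← intervalIntegral.integral_ofReal]
    simp_rw [h1]
    rw [intervalIntegral.integral_finsetSum fun k _ => by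
      apply Continuous.intervalIntegrable; fun_prop]
    push_cast
    rw [Finset.mul_sum]
    refine Finset.sum_congr rfl fun k hk => ?_
    rw [intervalIntegral.integral_finsetSum fun k _ => by
      apply Continuous.intervalIntegrable; fun_prop]
    simp_rw [intervalIntegral.integral_const_mul]
    rw [Finset.sum_eq_single_of_mem k hk]
    · have := integral_exp_int_mul (k - k)
      push_cast at this
      rw [this]
      simp
      ring
    · intro l _ hl
      have := integral_exp_int_mul (k - l)
      push_cast at this
      rw [this, if_neg (sub_ne_zero.2 hl.symm), mul_zero]
  exact_mod_cast h2

theorem conv_eq_sum {n : ℕ} {a : ℤ → ℝ} (ha : ∀ k : ℤ, (n : ℤ) < |k| → a k = 0) (b : ℤ → ℝ)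
    (k : ℤ) : conv a b k = ∑ l ∈ Finset.Icc (-n : ℤ) n, a l * b (k - l) := by
  refine tsum_eq_sum fun l hl => ?_
  rw [ha l (by rw [Finset.mem_Icc, ← abs_le] at hl; omega), zero_mul]

theorem conv_self_eq_zero {n : ℕ} {a : ℤ → ℝ} (ha : ∀ k : ℤ, (n : ℤ) < |k| → a k = 0) {k : ℤ}
    (hk : ((2 * n : ℕ) : ℤ) < |k|) : conv a a k = 0 := by
  rw [conv_eq_sum ha]
  refine Finset.sum_eq_zero fun l hl => ?_
  rw [ha (k - l), mul_zero]
  rw [Finset.mem_Icc, ← abs_le] at hl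
  have := abs_sub_abs_le_abs_sub k l
  push_cast at hk
  omega

theorem trigPoly_sq {n : ℕ} {a : ℤ → ℝ} (ha : ∀ k : ℤ, (n : ℤ) < |k| → a k = 0) (t : ℝ) :
    trigPoly n a t ^ 2 = trigPoly (2 * n) (conv a a) t := by
  simp only [trigPoly, conv_eq_sum ha, sq, Finset.sum_mul_sum]
  push_cast
  simp_rw [Finset.sum_mul]
  rw [Finset.sum_comm]
  conv_rhs => rw [Finset.sum_comm]
  rw [Finset.sum_comm]
  refine Finset.sum_congr rfl fun l hl => ?_
  rw [Finset.mem_Icc] at hl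
  set F : ℤ → ℂ := fun k => (a l : ℂ) * a (k - l) * Complex.exp (k * t * Complex.I) with hF
  have h1 : ∀ j : ℤ, (a l : ℂ) * Complex.exp (l * t * Complex.I) *
      (a j * Complex.exp (j * t * Complex.I)) = F (addRightEmbedding l j) := by
    intro j
    simp only [hF, addRightEmbedding_apply, add_sub_cancel_right]
    rw [mul_mul_mul_comm, ← Complex.exp_add]
    congr 2
    push_cast
    ring
  simp_rw [h1]
  rw [← Finset.sum_map]
  refine Finset.sum_subset ?_ ?_
  · intro k hk
    simp only [Finset.mem_map, Finset.mem_Icc, addRightEmbedding_apply] at hk ⊢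
    omega
  · intro k _ hk
    simp only [hF]
    rw [ha (k - l)]
    · simp
    · by_contra h
      refine hk (Finset.mem_map.2 ⟨k - l, ?_, by simp⟩)
      rw [Finset.mem_Icc, ← abs_le]
      omega

theorem quartic_eq_sum {n : ℕ} {a : ℤ → ℝ} (ha : ∀ k : ℤ, (n : ℤ) < |k| → a k = 0) :
    quartic a = ENNReal.ofReal
      (∑ k ∈ Finset.Icc (-(2 * n : ℕ) : ℤ) (2 * n : ℕ), conv a a k ^ 2) := by
  rw [ENNReal.ofReal_sum_of_nonneg fun _ _ => sq_nonneg _]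
  refine tsum_eq_sum fun k hk => ?_
  rw [conv_self_eq_zero ha (by rw [Finset.mem_Icc, ← abs_le] at hk; omega)]
  simp

/-- Parseval's identity for the square of the polynomial, whose coefficients are `conv a a`. -/
theorem quartic_eq_integral {n : ℕ} {a : ℤ → ℝ} (ha : ∀ k : ℤ, (n : ℤ) < |k| → a k = 0) :
    quartic a = ENNReal.ofReal
      ((2 * Real.pi)⁻¹ * ∫ t in (0 : ℝ)..(2 * Real.pi), ‖trigPoly n a t‖ ^ 4) := by
  have h : ∀ t, ‖trigPoly n a t‖ ^ 4 = ‖trigPoly (2 * n) (conv a a) t‖ ^ 2 := fun t => by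
    rw [← trigPoly_sq ha, norm_pow]; ring
  simp_rw [h]
  rw [quartic_eq_sum ha, integral_norm_trigPoly_sq, inv_mul_cancel_left₀ (by positivity)]

theorem norm_add_pow_four_add_norm_sub_pow_four_le (x y : ℂ) :
    ‖x + y‖ ^ 4 + ‖x - y‖ ^ 4 ≤ 8 * (‖x‖ ^ 4 + ‖y‖ ^ 4) := by
  have h := parallelogram_law_with_norm ℝ x y
  have h1 : ‖x + y‖ ^ 2 + ‖x - y‖ ^ 2 = 2 * (‖x‖ ^ 2 + ‖y‖ ^ 2) := by
    simpa only [sq] using h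
  have h2 : ‖x + y‖ ^ 4 + ‖x - y‖ ^ 4 + 2 * (‖x + y‖ ^ 2 * ‖x - y‖ ^ 2) =
      (2 * (‖x‖ ^ 2 + ‖y‖ ^ 2)) ^ 2 := by
    rw [← h1]; ring
  have h3 : 0 ≤ ‖x + y‖ ^ 2 * ‖x - y‖ ^ 2 := by positivity
  -- The cross term is dropped, and 4(A + B)² ≤ 8(A² + B²) with A = ‖x‖², B = ‖y‖².
  nlinarith [sq_nonneg (‖x‖ ^ 2 - ‖y‖ ^ 2)]

theorem quartic_add_add_quartic_sub_le_of_finite {n : ℕ} {a b : ℤ → ℝ}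
    (ha : ∀ k : ℤ, (n : ℤ) < |k| → a k = 0) (hb : ∀ k : ℤ, (n : ℤ) < |k| → b k = 0) :
    quartic (a + b) + quartic (a - b) ≤ 8 * (quartic a + quartic b) := by
  have hint : ∀ c : ℤ → ℝ, IntervalIntegrable (fun t => ‖trigPoly n c t‖ ^ 4) volume 0
      (2 * Real.pi) := fun c =>
    ((continuous_trigPoly n c).norm.pow 4).intervalIntegrable _ _
  have hpos : ∀ c : ℤ → ℝ, 0 ≤ (2 * Real.pi)⁻¹ *
      ∫ t in (0 : ℝ)..(2 * Real.pi), ‖trigPoly n c t‖ ^ 4 := fun c =>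
    mul_nonneg (by positivity)
      (intervalIntegral.integral_nonneg (by positivity) fun _ _ => by positivity)
  rw [quartic_eq_integral (n := n) (a := a + b) fun k hk => by simp [ha k hk, hb k hk],
    quartic_eq_integral (n := n) (a := a - b) fun k hk => by simp [ha k hk, hb k hk],
    quartic_eq_integral ha, quartic_eq_integral hb, ← ENNReal.ofReal_add (hpos _) (hpos _),
    ← ENNReal.ofReal_add (hpos _) (hpos _), ← ENNReal.ofReal_ofNat 8,
    ← ENNReal.ofReal_mul (by norm_num), ← mul_add, ← mul_add, mul_left_comm]
  refine ENNReal.ofReal_le_ofReal (mul_le_mul_of_nonneg_left ?_ (by positivity))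
  rw [← intervalIntegral.integral_add (hint _) (hint _),
    ← intervalIntegral.integral_add (hint _) (hint _), ← intervalIntegral.integral_const_mul]
  refine intervalIntegral.integral_mono_on (by positivity) ((hint _).add (hint _))
    (((hint _).add (hint _)).const_mul 8) fun t _ => ?_
  rw [trigPoly_add, trigPoly_sub]
  exact norm_add_pow_four_add_norm_sub_pow_four_le _ _

/-! ## Fejér means -/

/-- The Fejér multiplier `(1 - |k| / (N + 1))₊`. -/
noncomputable def fejerWeight (N : ℕ) (k : ℤ) : ℝ := max 0 (1 - |(k : ℝ)| / (N + 1))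

/-- The Fejér mean of a sequence of Fourier coefficients. -/
noncomputable def fejer (N : ℕ) (z : ℤ → ℝ) (k : ℤ) : ℝ := fejerWeight N k * z k

theorem fejerWeight_nonneg (N : ℕ) (k : ℤ) : 0 ≤ fejerWeight N k := le_max_left _ _

theorem fejerWeight_le_one (N : ℕ) (k : ℤ) : fejerWeight N k ≤ 1 :=
  max_le zero_le_one (sub_le_self _ (by positivity))

theorem fejerWeight_eq_zero {N : ℕ} {k : ℤ} (hk : (N : ℤ) < |k|) : fejerWeight N k = 0 := by
  refine max_eq_left (sub_nonpos.2 ((one_le_div (by positivity)).2 ?_))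
  exact_mod_cast hk

theorem mul_fejerWeight {N : ℕ} {k : ℤ} (hk : |k| ≤ N + 1) :
    (N + 1) * fejerWeight N k = N + 1 - |(k : ℝ)| := by
  have h : |(k : ℝ)| ≤ N + 1 := by exact_mod_cast hk
  rw [fejerWeight, max_eq_right (sub_nonneg.2 ((div_le_one (by positivity)).2 h)), mul_sub,
    mul_div_cancel₀ _ (by positivity), mul_one]

theorem tendsto_fejerWeight (k : ℤ) : Tendsto (fun N => fejerWeight N k) atTop (𝓝 1) := by
  have h : Tendsto (fun N : ℕ => 1 - |(k : ℝ)| / (N + 1)) atTop (𝓝 (1 - 0)) :=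
    tendsto_const_nhds.sub (tendsto_const_nhds.div_atTop
      (tendsto_atTop_add_const_right _ _ tendsto_natCast_atTop_atTop))
  simpa [fejerWeight] using (tendsto_const_nhds (x := (0 : ℝ))).max h

theorem fejer_eq_zero {N : ℕ} (z : ℤ → ℝ) (k : ℤ) (hk : (N : ℤ) < |k|) : fejer N z k = 0 := by
  rw [fejer, fejerWeight_eq_zero hk, zero_mul]

theorem abs_fejer_le (N : ℕ) (z : ℤ → ℝ) (k : ℤ) : |fejer N z k| ≤ |z k| := by
  rw [fejer, abs_mul, abs_of_nonneg (fejerWeight_nonneg N k)]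
  exact mul_le_of_le_one_left (abs_nonneg _) (fejerWeight_le_one N k)

theorem fejer_sq_le (N : ℕ) (z : ℤ → ℝ) (k : ℤ) : fejer N z k ^ 2 ≤ z k ^ 2 :=
  sq_le_sq.2 (abs_fejer_le N z k)

theorem IsOddSq.fejer {z : ℤ → ℝ} (hz : IsOddSq z) (N : ℕ) : IsOddSq (fejer N z) where
  odd k := by
    have : fejerWeight N (-k) = fejerWeight N k := by simp [fejerWeight]
    rw [Breather.fejer, Breather.fejer, this, hz.odd k]
    ring
  summable := hz.summable.of_nonneg_of_le (fun _ => sq_nonneg _) (fejer_sq_le N z)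

theorem fejer_add (N : ℕ) (a b : ℤ → ℝ) : fejer N (a + b) = fejer N a + fejer N b := by
  funext k
  simp [fejer, mul_add]

theorem fejer_sub (N : ℕ) (a b : ℤ → ℝ) : fejer N (a - b) = fejer N a - fejer N b := by
  funext k
  simp [fejer, mul_sub]

theorem tendsto_fejer (z : ℤ → ℝ) (k : ℤ) : Tendsto (fun N => fejer N z k) atTop (𝓝 (z k)) := by
  simpa [fejer] using (tendsto_fejerWeight k).mul_const (z k)

theorem sum_Icc_eq_sum_range (φ : ℤ → ℂ) (n : ℕ) :
    ∑ k ∈ Finset.Icc (-n : ℤ) n, φ k =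
      φ 0 + ∑ i ∈ Finset.range n, (φ (n - i) + φ (i - n)) := by
  induction n with
  | zero => simp
  | succ n ih =>
    push_cast
    rw [Finset.sum_Icc_succ_eq_add_endpoints, ih, Finset.sum_range_succ']
    push_cast
    simp only [add_sub_add_right_eq_sub, sub_zero, zero_sub]
    ring

/-- A difference k occurs n - |k| times in an n × n square, which produces the Fejér weights. In the
induction, the added row and column contribute each difference in [-n, n] once. -/
theorem sum_range_sum_range_sub (φ : ℤ → ℂ) (n : ℕ) :
    ∑ i ∈ Finset.range n, ∑ j ∈ Finset.range n, φ (i - j) =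
      ∑ k ∈ Finset.Icc (-n : ℤ) n, ((n : ℂ) - (|k| : ℤ)) * φ k := by
  induction n with
  | zero => simp
  | succ n ih =>
    have h1 : ∑ i ∈ Finset.range (n + 1), ∑ j ∈ Finset.range (n + 1), φ (i - j) =
        ∑ i ∈ Finset.range n, ∑ j ∈ Finset.range n, φ (i - j) +
          ∑ k ∈ Finset.Icc (-n : ℤ) n, φ k := by
      rw [sum_Icc_eq_sum_range, Finset.sum_range_succ]
      simp_rw [Finset.sum_range_succ _ n]
      simp only [Finset.sum_add_distrib, sub_self]
      ring
    rw [h1, ih, ← Finset.sum_add_distrib]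
    push_cast
    rw [Finset.sum_Icc_succ_eq_add_endpoints]
    have h2 : |(n : ℤ) + 1| = n + 1 := abs_of_nonneg (by positivity)
    rw [abs_neg, h2]
    push_cast
    simp only [sub_self, zero_mul, zero_add]
    exact Finset.sum_congr rfl fun k _ => by ring

/-- Jensen's inequality for convolution with the Fejér kernel, in terms of Fourier coefficients:
`w` are the coefficients of an (imaginary valued) function, `W` those of its square. -/
theorem norm_fejer_sum_sq_le {w W : ℤ → ℂ} (hw : ∀ k, (starRingEnd ℂ) (w k) = -w (-k))
    (hW : ∀ k, HasSum (fun l => w l * w (k - l)) (W k)) (n : ℕ) :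
    ‖∑ k ∈ Finset.Icc (-n : ℤ) n, ((n : ℂ) - (|k| : ℤ)) * w k‖ ^ 2 ≤
      n * ‖∑ k ∈ Finset.Icc (-n : ℤ) n, ((n : ℂ) - (|k| : ℤ)) * W k‖ := by
  set D : ℤ → ℂ := fun m => ∑ j ∈ Finset.range n, w (m - j) with hD
  rw [← sum_range_sum_range_sub, ← sum_range_sum_range_sub]
  -- By `hw`, conjugating a factor of |D m|² reverses its index and changes the sign; summing over
  -- all m in ℤ then turns the products into values of -W.
  have h1 : HasSum (fun m : ℤ => ((‖D m‖ ^ 2 : ℝ) : ℂ))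
      (∑ i ∈ Finset.range n, ∑ j ∈ Finset.range n, -W (i - j)) := by
    have h2 : ∀ m : ℤ, ((‖D m‖ ^ 2 : ℝ) : ℂ) =
        ∑ i ∈ Finset.range n, ∑ j ∈ Finset.range n, -(w (m - j) * w (i - m)) := by
      intro m
      push_cast
      rw [← Complex.mul_conj', hD, map_sum, Finset.sum_mul_sum, Finset.sum_comm]
      refine Finset.sum_congr rfl fun i _ => Finset.sum_congr rfl fun j _ => ?_
      rw [hw, neg_sub]
      ring
    simp_rw [h2]
    refine hasSum_sum fun i _ => hasSum_sum fun j _ => HasSum.neg ?_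
    have h3 := (Equiv.subRight (j : ℤ)).hasSum_iff.2 (hW (i - j))
    refine h3.congr_fun fun m => ?_
    simp only [Function.comp_apply, Equiv.subRight_apply, sub_sub_sub_cancel_right]
  -- Discarding the nonnegative terms with m outside `range n` is the only loss apart from
  -- Cauchy–Schwarz below.
  have h2 : ∑ m ∈ Finset.range n, ‖D m‖ ^ 2 ≤
      ‖∑ i ∈ Finset.range n, ∑ j ∈ Finset.range n, W (i - j)‖ := by
    have h3 := Complex.hasSum_re h1
    simp only [Complex.ofReal_re] at h3
    have h4 := sum_le_hasSum ((Finset.range n).map Nat.castEmbedding)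
      (fun m _ => by positivity) h3
    rw [Finset.sum_map] at h4
    refine h4.trans ((Complex.re_le_norm _).trans ?_)
    simp_rw [Finset.sum_neg_distrib]
    rw [norm_neg]
  calc ‖∑ m ∈ Finset.range n, D m‖ ^ 2 ≤ (∑ m ∈ Finset.range n, ‖D m‖) ^ 2 := by
        gcongr; exact norm_sum_le _ _
    _ ≤ n * ∑ m ∈ Finset.range n, ‖D m‖ ^ 2 := by
        simpa using sq_sum_le_card_mul_sum_sq (s := Finset.range n) (f := fun m => ‖D m‖)
    _ ≤ _ := by gcongr

theorem mul_trigPoly_fejer (N : ℕ) (a : ℤ → ℝ) (t : ℝ) :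
    (N + 1) * trigPoly N (fejer N a) t =
      ∑ k ∈ Finset.Icc (-(N + 1 : ℕ) : ℤ) (N + 1 : ℕ), (((N + 1 : ℕ) : ℂ) - (|k| : ℤ)) *
        (a k * Complex.exp (k * t * Complex.I)) := by
  -- Widening the range to N + 1 is harmless, since the Fejér weight vanishes at |k| = N + 1.
  have h : trigPoly N (fejer N a) t = trigPoly (N + 1) (fejer N a) t := by
    refine Finset.sum_subset (Finset.Icc_subset_Icc (by push_cast; lia) (by push_cast; lia))
      fun k _ hk => ?_
    rw [fejer_eq_zero a k (by rw [Finset.mem_Icc, ← abs_le] at hk; omega)]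
    simp
  rw [h, trigPoly, Finset.mul_sum]
  refine Finset.sum_congr rfl fun k hk => ?_
  rw [Finset.mem_Icc, ← abs_le] at hk
  have h2 : ((N : ℂ) + 1) * fejerWeight N k = N + 1 - (|k| : ℤ) := by
    have := mul_fejerWeight (N := N) (k := k) (by exact_mod_cast hk)
    rw [← Int.cast_abs] at this
    have h3 : ((|k| : ℤ) : ℂ) = (((|k| : ℤ) : ℝ) : ℂ) := (Complex.ofReal_intCast _).symm
    rw [h3, ← Complex.ofReal_natCast, ← Complex.ofReal_one, ← Complex.ofReal_add,
      ← Complex.ofReal_mul, ← Complex.ofReal_sub, this]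
  push_cast [fejer] at h2 ⊢
  rw [← h2]
  ring

/-- The point t is absorbed by the modulation w_k = z_k exp(ikt). Real odd `z` gives exactly the
symmetry needed in `norm_fejer_sum_sq_le`, so no function with coefficients `z` has to be
constructed. -/
theorem norm_trigPoly_fejer_sq_le {z : ℤ → ℝ} (hz : IsOddSq z) (N : ℕ) (t : ℝ) :
    ‖trigPoly N (fejer N z) t‖ ^ 2 ≤ ‖trigPoly N (fejer N (conv z z)) t‖ := by
  have h := norm_fejer_sum_sq_le (w := fun k => z k * Complex.exp (k * t * Complex.I))
    (W := fun k => conv z z k * Complex.exp (k * t * Complex.I)) (fun k => ?_) (fun k => ?_) (N + 1)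
  · rw [← mul_trigPoly_fejer, ← mul_trigPoly_fejer, norm_mul, norm_mul] at h
    have h1 : ‖(N : ℂ) + 1‖ = N + 1 := by
      rw [← Nat.cast_succ, Complex.norm_natCast, Nat.cast_succ]
    rw [h1, mul_pow, Nat.cast_succ, ← mul_assoc, ← sq] at h
    exact le_of_mul_le_mul_left h (by positivity)
  · rw [map_mul, ← Complex.exp_conj, Complex.conj_ofReal, hz.odd k]
    simp
  · have h1 := (summable_mul_sub hz.summable hz.summable k).hasSum
    have h2 := (Complex.hasSum_ofReal.2 h1).mul_right (Complex.exp (k * t * Complex.I))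
    refine h2.congr_fun fun l => ?_
    push_cast
    rw [mul_mul_mul_comm, ← Complex.exp_add]
    congr 2
    ring

/-- Fejér means do not increase the quartic functional. -/
theorem quartic_fejer_le {z : ℤ → ℝ} (hz : IsOddSq z) (N : ℕ) :
    quartic (fejer N z) ≤ quartic z := by
  have hpi : 0 < 2 * Real.pi := by positivity
  calc quartic (fejer N z)
      = ENNReal.ofReal ((2 * Real.pi)⁻¹ *
          ∫ t in (0 : ℝ)..(2 * Real.pi), ‖trigPoly N (fejer N z) t‖ ^ 4) :=
        quartic_eq_integral (fejer_eq_zero z)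
    _ ≤ ENNReal.ofReal ((2 * Real.pi)⁻¹ *
          ∫ t in (0 : ℝ)..(2 * Real.pi), ‖trigPoly N (fejer N (conv z z)) t‖ ^ 2) := by
        refine ENNReal.ofReal_le_ofReal (mul_le_mul_of_nonneg_left ?_ (by positivity))
        refine intervalIntegral.integral_mono_on hpi.le
          (((continuous_trigPoly _ _).norm.pow 4).intervalIntegrable _ _)
          (((continuous_trigPoly _ _).norm.pow 2).intervalIntegrable _ _) fun t _ => ?_
        rw [show ‖trigPoly N (fejer N z) t‖ ^ 4 = (‖trigPoly N (fejer N z) t‖ ^ 2) ^ 2 by ring]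
        gcongr
        exact norm_trigPoly_fejer_sq_le hz N t
    _ = ∑ k ∈ Finset.Icc (-N : ℤ) N, ENNReal.ofReal (fejer N (conv z z) k ^ 2) := by
        rw [integral_norm_trigPoly_sq, inv_mul_cancel_left₀ hpi.ne',
          ENNReal.ofReal_sum_of_nonneg fun _ _ => sq_nonneg _]
    _ ≤ ∑ k ∈ Finset.Icc (-N : ℤ) N, ENNReal.ofReal (conv z z k ^ 2) :=
        Finset.sum_le_sum fun k _ => ENNReal.ofReal_le_ofReal (fejer_sq_le N _ k)
    _ ≤ quartic z := ENNReal.sum_le_tsum _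

/-! ## Lower semicontinuity and Clarkson's inequality -/

/-- Fatou's lemma for series. A bound along infinitely many n suffices, which the contradiction
argument in `tendsto_tripleNorm_sub` needs. -/
theorem tsum_le_of_tendsto {ι : Type*} {u : ℕ → ι → ℝ≥0∞} {v : ι → ℝ≥0∞} {B : ℝ≥0∞}
    (h : ∀ k, Tendsto (fun n => u n k) atTop (𝓝 (v k))) (hB : ∃ᶠ n in atTop, ∑' k, u n k ≤ B) :
    ∑' k, v k ≤ B := by
  refine ENNReal.summable.tsum_le_of_sum_le fun s => ?_
  exact le_of_tendsto_of_frequently (tendsto_finsetSum s fun k _ => h k)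
    (hB.mono fun n hn => (ENNReal.sum_le_tsum s).trans hn)

theorem tendsto_ofReal_conv_sq_fejer {z : ℤ → ℝ} (hz : IsOddSq z) (k : ℤ) :
    Tendsto (fun N => ENNReal.ofReal (conv (fejer N z) (fejer N z) k ^ 2)) atTop
      (𝓝 (ENNReal.ofReal (conv z z k ^ 2))) := by
  refine ENNReal.tendsto_ofReal (Tendsto.pow ?_ 2)
  refine tendsto_tsum_of_dominated_convergence
    (summable_mul_sub hz.summable hz.summable k).norm
    (fun l => (tendsto_fejer z l).mul (tendsto_fejer z (k - l))) (Eventually.of_forall fun N l => ?_)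
  rw [norm_mul, norm_mul]
  exact mul_le_mul (abs_fejer_le N z l) (abs_fejer_le N z (k - l)) (norm_nonneg _) (norm_nonneg _)

theorem quartic_le_of_fejer {z : ℤ → ℝ} (hz : IsOddSq z) {B : ℝ≥0∞}
    (h : ∀ N, quartic (fejer N z) ≤ B) : quartic z ≤ B :=
  tsum_le_of_tendsto (tendsto_ofReal_conv_sq_fejer hz) (Frequently.of_forall h)

/-- The sublevel sets of the quartic functional are closed under coordinatewise convergence. -/
theorem quartic_le_of_tendsto {u : ℕ → ℤ → ℝ} {z : ℤ → ℝ} {B : ℝ≥0∞} (hz : IsOddSq z)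
    (hu : ∀ n, IsOddSq (u n)) (h : ∀ k, Tendsto (fun n => u n k) atTop (𝓝 (z k)))
    (hB : ∃ᶠ n in atTop, quartic (u n) ≤ B) : quartic z ≤ B := by
  -- Coordinatewise convergence need not pass to the infinite sums `conv (u n) (u n) k`. For fixed N
  -- the Fejér means involve finitely many coordinates, so there it does.
  refine quartic_le_of_fejer hz fun N => ?_
  refine tsum_le_of_tendsto
    (u := fun n k => ENNReal.ofReal (conv (fejer N (u n)) (fejer N (u n)) k ^ 2)) (fun k => ?_) ?_
  · refine ENNReal.tendsto_ofReal (Tendsto.pow ?_ 2)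
    simp_rw [conv_eq_sum (fejer_eq_zero _)]
    exact tendsto_finsetSum _ fun l _ => ((h l).const_mul _).mul ((h (k - l)).const_mul _)
  · exact hB.mono fun n hn => (quartic_fejer_le (hu n) N).trans hn

theorem isOddSq_of_tendsto {u : ℕ → ℤ → ℝ} {z : ℤ → ℝ} {R : ℝ}
    (hu : ∀ n, IsOddSq (u n)) (h : ∀ k, Tendsto (fun n => u n k) atTop (𝓝 (z k)))
    (hR : ∀ n, ∑' k, u n k ^ 2 ≤ R) : IsOddSq z ∧ ∑' k, z k ^ 2 ≤ R := by
  have hs : ∀ s : Finset ℤ, ∑ k ∈ s, z k ^ 2 ≤ R := fun s =>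
    le_of_tendsto' (tendsto_finsetSum s fun k _ => (h k).pow 2) fun n =>
      ((hu n).summable.sum_le_tsum s fun _ _ => sq_nonneg _).trans (hR n)
  have hsum : Summable fun k => z k ^ 2 :=
    summable_of_sum_le (fun _ => sq_nonneg _) hs
  refine ⟨⟨fun k => ?_, hsum⟩, hsum.tsum_le_of_sum_le hs⟩
  refine tendsto_nhds_unique (h k) ((h (-k)).neg.congr fun n => ((hu n).odd k).symm)

/-- The finite inequality holds for the Fejér means with a bound independent of N; Fatou's lemma is
applied to the two series added termwise. -/
theorem quartic_add_add_quartic_sub_le {a b : ℤ → ℝ} (ha : IsOddSq a) (hb : IsOddSq b) :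
    quartic (a + b) + quartic (a - b) ≤ 8 * (quartic a + quartic b) := by
  have key : ∀ N, quartic (fejer N (a + b)) + quartic (fejer N (a - b)) ≤
      8 * (quartic a + quartic b) := fun N => by
    rw [fejer_add, fejer_sub]
    refine (quartic_add_add_quartic_sub_le_of_finite (fejer_eq_zero a) (fejer_eq_zero b)).trans ?_
    gcongr
    · exact quartic_fejer_le ha N
    · exact quartic_fejer_le hb N
  simp only [quartic, ← ENNReal.tsum_add] at key ⊢
  exact tsum_le_of_tendsto (fun k => (tendsto_ofReal_conv_sq_fejer (ha.add hb) k).add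
    (tendsto_ofReal_conv_sq_fejer (ha.sub hb) k)) (Frequently.of_forall key)

/-! ## The quadratic part and the energy -/

/-- The quadratic part of the functional. -/
noncomputable def lin (c z : ℤ → ℝ) : ℝ := ∑' k, c k * z k ^ 2

/-- The functional in terms of `quartic`. -/
noncomputable def energy (c z : ℤ → ℝ) : ℝ := 1 / 4 * (quartic z).toReal + lin c z

theorem tail_lin_le {c z : ℤ → ℝ} {C : ℝ} (hz : IsOddSq z) (s : Finset ℤ)
    (hs : ∀ k ∉ s, |c k| ≤ C) (hC : 0 ≤ C) (hsum : Summable fun k => c k * z k ^ 2) :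
    |lin c z - ∑ k ∈ s, c k * z k ^ 2| ≤ C * ∑' k, z k ^ 2 := by
  rw [lin, ← hsum.sum_add_tsum_compl (s := s), add_sub_cancel_left, ← tsum_mul_left]
  have h1 : Summable fun k => C * z k ^ 2 := hz.summable.mul_left C
  refine (tsum_of_norm_bounded (f := fun k : ((s : Set ℤ)ᶜ : Set ℤ) => c k * z k ^ 2)
    (h1.subtype _).hasSum fun k => ?_).trans
    (h1.tsum_subtype_le _ _ fun _ => by positivity)
  rw [norm_mul, Real.norm_eq_abs, Real.norm_eq_abs, abs_of_nonneg (sq_nonneg (z k))]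
  exact mul_le_mul_of_nonneg_right (hs k fun hk => k.2 hk) (sq_nonneg _)

theorem summable_lin {c z : ℤ → ℝ} {C : ℝ} (hc : ∀ k, |c k| ≤ C) (hz : IsOddSq z) :
    Summable fun k => c k * z k ^ 2 := by
  refine Summable.of_norm_bounded (hz.summable.mul_left C) fun k => ?_
  rw [norm_mul, Real.norm_eq_abs, Real.norm_eq_abs, abs_of_nonneg (sq_nonneg (z k))]
  exact mul_le_mul_of_nonneg_right (hc k) (sq_nonneg _)

theorem abs_lin_le {c z : ℤ → ℝ} {C : ℝ} (hc : ∀ k, |c k| ≤ C) (hz : IsOddSq z) :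
    |lin c z| ≤ C * ∑' k, z k ^ 2 := by
  simpa using tail_lin_le hz ∅ (fun k _ => hc k) ((abs_nonneg _).trans (hc 0)) (summable_lin hc hz)

/-- The quadratic part is continuous under bounded coordinatewise convergence if its
coefficients tend to zero. -/
theorem tendsto_lin {c : ℤ → ℝ} (hc : Tendsto c cofinite (𝓝 0)) {C : ℝ} (hcC : ∀ k, |c k| ≤ C)
    {u : ℕ → ℤ → ℝ} {z : ℤ → ℝ} {R : ℝ} (hu : ∀ n, IsOddSq (u n))
    (h : ∀ k, Tendsto (fun n => u n k) atTop (𝓝 (z k))) (hR : ∀ n, ∑' k, u n k ^ 2 ≤ R) :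
    Tendsto (fun n => lin c (u n)) atTop (𝓝 (lin c z)) := by
  obtain ⟨hz, hzR⟩ := isOddSq_of_tendsto hu h hR
  have hR0 : 0 ≤ R := (tsum_nonneg fun k => sq_nonneg (z k)).trans hzR
  rw [Metric.tendsto_atTop]
  intro ε hε
  set δ := ε / (3 * (R + 1)) with hδ
  have hδ0 : 0 < δ := by positivity
  have hδR : δ * R < ε / 3 := by
    rw [hδ, div_mul_eq_mul_div, div_lt_div_iff₀ (by positivity) (by norm_num)]
    nlinarith
  -- Finitely many coordinates carry all coefficients above δ; the remaining tails are below ε/3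
  -- uniformly in n.
  have hfin : {k | ¬ |c k| ≤ δ}.Finite := by
    have := hc.eventually (Metric.closedBall_mem_nhds 0 hδ0)
    rw [Filter.eventually_cofinite] at this
    simpa using this
  set s := hfin.toFinset with hs
  have hs' : ∀ k ∉ s, |c k| ≤ δ := fun k hk => by
    by_contra h'
    exact hk (hfin.mem_toFinset.2 h')
  have htail : ∀ y : ℤ → ℝ, IsOddSq y → ∑' k, y k ^ 2 ≤ R →
      |lin c y - ∑ k ∈ s, c k * y k ^ 2| < ε / 3 := fun y hy hyR =>
    ((tail_lin_le hy s hs' hδ0.le (summable_lin hcC hy)).trans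
      (mul_le_mul_of_nonneg_left hyR hδ0.le)).trans_lt hδR
  have hmain : Tendsto (fun n => ∑ k ∈ s, c k * u n k ^ 2) atTop (𝓝 (∑ k ∈ s, c k * z k ^ 2)) :=
    tendsto_finsetSum s fun k _ => ((h k).pow 2).const_mul _
  obtain ⟨N, hN⟩ := Metric.tendsto_atTop.1 hmain (ε / 3) (by positivity)
  refine ⟨N, fun n hn => ?_⟩
  have h1 := abs_lt.1 (htail (u n) (hu n) (hR n))
  have h2 := abs_lt.1 (htail z hz hzR)
  have h3 := hN n hn
  rw [Real.dist_eq, abs_lt] at h3 ⊢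
  constructor <;> linarith [h1.1, h1.2, h2.1, h2.2, h3.1, h3.2]

theorem sq_tsum_sq_le {z : ℤ → ℝ} (hz : z ∈ DomJ) :
    (∑' k, z k ^ 2) ^ 2 ≤ (quartic z).toReal := by
  obtain ⟨-, h1, h2⟩ := mem_domJ_iff.1 hz
  exact (ENNReal.ofReal_le_iff_le_toReal h2.ne).1 (sq_tsum_sq_le_quartic h1.odd)

theorem neg_sq_le_energy {c z : ℤ → ℝ} {C : ℝ} (hc : ∀ k, |c k| ≤ C) (hz : z ∈ DomJ) :
    -C ^ 2 ≤ energy c z := by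
  have h1 := (abs_le.1 (abs_lin_le hc (mem_domJ_iff.1 hz).2.1)).1
  have h2 := sq_tsum_sq_le hz
  rw [energy]
  -- With S = ∑ z_k², the energy is at least S²/4 - CS = (S/2 - C)² - C².
  nlinarith [sq_nonneg ((∑' k, z k ^ 2) - 2 * C)]

theorem tsum_sq_le_of_energy_le_one {c z : ℤ → ℝ} {C : ℝ} (hc : ∀ k, |c k| ≤ C) (hz : z ∈ DomJ)
    (h : energy c z ≤ 1) : ∑' k, z k ^ 2 ≤ 4 * C + 2 := by
  have h1 := (abs_le.1 (abs_lin_le hc (mem_domJ_iff.1 hz).2.1)).1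
  have h2 := sq_tsum_sq_le hz
  have hC : 0 ≤ C := (abs_nonneg _).trans (hc 0)
  rw [energy] at h
  by_contra! h3
  nlinarith

theorem quartic_zero : quartic 0 = 0 := by
  have := quartic_smul 0 0
  simpa using this

theorem energy_zero (c : ℤ → ℝ) : energy c 0 = 0 := by simp [energy, quartic_zero, lin]

theorem zero_mem_domJ : (0 : ℤ → ℝ) ∈ DomJ :=
  mem_domJ_iff.2 ⟨fun _ _ => rfl, ⟨fun _ => by simp, by simp⟩, by
    simp [quartic_zero]⟩

theorem zero_mem_domJN (N : ℕ) : (0 : ℤ → ℝ) ∈ DomJN N := ⟨zero_mem_domJ, fun _ _ => rfl⟩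

theorem fejer_mem_domJN {z : ℤ → ℝ} (hz : z ∈ DomJ) (N : ℕ) : fejer N z ∈ DomJN N := by
  obtain ⟨h0, h1, h2⟩ := mem_domJ_iff.1 hz
  refine ⟨mem_domJ_iff.2 ⟨fun k hk => by simp [fejer, h0 k hk], h1.fejer N,
    (quartic_fejer_le h1 N).trans_lt h2⟩, fejer_eq_zero z⟩

/-! ## Compactness -/

/-- Tychonoff's theorem in a countable product of compact intervals. -/
theorem exists_subseq_tendsto {u : ℕ → ℤ → ℝ} {R : ℝ} (hu : ∀ n, IsOddSq (u n))
    (hR : ∀ n, ∑' k, u n k ^ 2 ≤ R) :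
    ∃ z : ℤ → ℝ, ∃ φ : ℕ → ℕ, StrictMono φ ∧
      ∀ k, Tendsto (fun n => u (φ n) k) atTop (𝓝 (z k)) := by
  have hK : IsCompact (Set.univ.pi fun _ : ℤ => Set.Icc (-(R + 1)) (R + 1)) :=
    isCompact_univ_pi fun _ => isCompact_Icc
  obtain ⟨z, -, φ, hφ, h⟩ := hK.tendsto_subseq (x := u) fun n k _ => by
    have h1 : u n k ^ 2 ≤ R :=
      ((hu n).summable.le_tsum k fun _ _ => sq_nonneg _).trans (hR n)
    constructor <;> nlinarith [sq_nonneg (u n k - 1), sq_nonneg (u n k + 1)]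
  exact ⟨z, φ, hφ, fun k => (tendsto_pi_nhds.1 h) k⟩

section

variable {c : ℤ → ℝ} {C : ℝ} {u : ℕ → ℤ → ℝ} {z : ℤ → ℝ} {ℓ : ℝ}

theorem tendsto_quartic_toReal (hc : Tendsto c cofinite (𝓝 0)) (hcC : ∀ k, |c k| ≤ C)
    (hu : ∀ n, u n ∈ DomJ) (h1 : ∀ n, energy c (u n) ≤ 1)
    (h : ∀ k, Tendsto (fun n => u n k) atTop (𝓝 (z k)))
    (hℓ : Tendsto (fun n => energy c (u n)) atTop (𝓝 ℓ)) :
    Tendsto (fun n => (quartic (u n)).toReal) atTop (𝓝 (4 * (ℓ - lin c z))) := by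
  have h2 := tendsto_lin hc hcC (fun n => (mem_domJ_iff.1 (hu n)).2.1) h
    fun n => tsum_sq_le_of_energy_le_one hcC (hu n) (h1 n)
  refine ((hℓ.sub h2).const_mul 4).congr fun n => ?_
  rw [energy]
  ring

/-- The energy is lower semicontinuous under coordinatewise convergence. -/
theorem mem_domJ_and_energy_le (hc : Tendsto c cofinite (𝓝 0)) (hcC : ∀ k, |c k| ≤ C)
    (hu : ∀ n, u n ∈ DomJ) (h1 : ∀ n, energy c (u n) ≤ 1)
    (h : ∀ k, Tendsto (fun n => u n k) atTop (𝓝 (z k)))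
    (hℓ : Tendsto (fun n => energy c (u n)) atTop (𝓝 ℓ)) : z ∈ DomJ ∧ energy c z ≤ ℓ := by
  have hu' := fun n => (mem_domJ_iff.1 (hu n)).2.1
  obtain ⟨hz, -⟩ := isOddSq_of_tendsto hu' h
    fun n => tsum_sq_le_of_energy_le_one hcC (hu n) (h1 n)
  have hq := tendsto_quartic_toReal hc hcC hu h1 h hℓ
  have hle : ∀ B, 4 * (ℓ - lin c z) < B → quartic z ≤ ENNReal.ofReal B := fun B hB => by
    refine quartic_le_of_tendsto hz hu' h (Eventually.frequently ?_)
    filter_upwards [hq.eventually (gt_mem_nhds hB)] with n hn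
    exact (ENNReal.le_ofReal_iff_toReal_le (mem_domJ_iff.1 (hu n)).2.2.ne
      (ENNReal.toReal_nonneg.trans hn.le)).2 hn.le
  have hL : 0 ≤ 4 * (ℓ - lin c z) := ge_of_tendsto' hq fun n => ENNReal.toReal_nonneg
  refine ⟨mem_domJ_iff.2 ⟨fun k hk => ?_, hz,
    (hle _ (lt_add_one _)).trans_lt ENNReal.ofReal_lt_top⟩, ?_⟩
  · refine tendsto_nhds_unique (h k) ?_
    simp only [(mem_domJ_iff.1 (hu _)).1 k hk]
    exact tendsto_const_nhds
  · have : (quartic z).toReal ≤ 4 * (ℓ - lin c z) := le_of_forall_gt_imp_ge_of_dense fun B hB =>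
      ENNReal.toReal_le_of_le_ofReal (hL.trans hB.le) (hle B hB)
    rw [energy]
    linarith

/-- Coordinatewise convergence together with convergence of the energies is norm convergence. -/
theorem tendsto_tripleNorm_sub (hc : Tendsto c cofinite (𝓝 0)) (hcC : ∀ k, |c k| ≤ C)
    (hu : ∀ n, u n ∈ DomJ) (h1 : ∀ n, energy c (u n) ≤ 1)
    (h : ∀ k, Tendsto (fun n => u n k) atTop (𝓝 (z k))) (hzD : z ∈ DomJ)
    (hℓ : Tendsto (fun n => energy c (u n)) atTop (𝓝 (energy c z))) :
    Tendsto (fun n => tripleNorm (u n - z)) atTop (𝓝 0) := by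
  have hu' := fun n => (mem_domJ_iff.1 (hu n)).2.1
  have hufin := fun n => (mem_domJ_iff.1 (hu n)).2.2
  obtain ⟨-, hz, hzfin⟩ := mem_domJ_iff.1 hzD
  set q := (quartic z).toReal with hqdef
  have hq : Tendsto (fun n => (quartic (u n)).toReal) atTop (𝓝 q) := by
    have := tendsto_quartic_toReal hc hcC hu h1 h hℓ
    rw [energy] at this
    convert this using 2
    ring
  have hclark := fun n => quartic_add_add_quartic_sub_le (hu' n) hz
  have hfin : ∀ n, 8 * (quartic (u n) + quartic z) < ∞ := fun n =>
    ENNReal.mul_lt_top (by simp) (ENNReal.add_lt_top.2 ⟨hufin n, hzfin⟩)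
  have haddfin : ∀ n, quartic (u n + z) < ∞ := fun n =>
    (le_self_add.trans (hclark n)).trans_lt (hfin n)
  have hsubfin : ∀ n, quartic (u n - z) < ∞ := fun n =>
    (le_add_self.trans (hclark n)).trans_lt (hfin n)
  have hclark' : ∀ n, (quartic (u n + z)).toReal + (quartic (u n - z)).toReal ≤
      8 * ((quartic (u n)).toReal + q) := fun n => by
    have := ENNReal.toReal_mono (hfin n).ne (hclark n)
    rwa [ENNReal.toReal_add (haddfin n).ne (hsubfin n).ne, ENNReal.toReal_mul,
      ENNReal.toReal_add (hufin n).ne hzfin.ne, ENNReal.toReal_ofNat] at this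
  have hd : Tendsto (fun n => (quartic (u n - z)).toReal) atTop (𝓝 0) := by
    refine tendsto_order.2 ⟨fun a ha => Eventually.of_forall fun n =>
      ha.trans_le ENNReal.toReal_nonneg, fun ε hε => ?_⟩
    by_contra hcon
    have hev : ∀ᶠ n in atTop, (quartic (u n)).toReal < q + ε / 16 :=
      hq.eventually (gt_mem_nhds (by linarith))
    -- If the difference is at least ε infinitely often, Clarkson leaves at most 8(2q + ε/16) - ε =
    -- 16q - ε/2 for the sum.
    have hfr : ∃ᶠ n in atTop, (quartic (u n + z)).toReal ≤ 16 * q - ε / 2 := by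
      refine ((not_eventually.1 hcon).and_eventually hev).mono fun n hn => ?_
      linarith [hclark' n, not_lt.1 hn.1, hn.2]
    obtain ⟨m, hm⟩ := hfr.exists
    have hnn : 0 ≤ 16 * q - ε / 2 := ENNReal.toReal_nonneg.trans hm
    -- The sums converge coordinatewise to 2z, whose quartic value is 16q; lower semicontinuity
    -- contradicts the bound just obtained.
    have h5 := quartic_le_of_tendsto (hz.smul 2) (fun n => (hu' n).add hz) (fun k => by
      have := (h k).add_const (z k)
      rw [← two_mul] at this
      exact this) (hfr.mono fun n hn =>
        (ENNReal.le_ofReal_iff_toReal_le (haddfin n).ne hnn).2 hn)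
    have h6 := ENNReal.toReal_le_of_le_ofReal hnn h5
    rw [quartic_smul, ENNReal.toReal_mul, ENNReal.toReal_ofReal (by norm_num), ← hqdef] at h6
    linarith
  have hd' : Tendsto (fun n => quartic (u n - z)) atTop (𝓝 0) := by
    rwa [← ENNReal.tendsto_toReal_iff (fun n => (hsubfin n).ne) ENNReal.zero_ne_top]
  have := (ENNReal.continuous_rpow_const (y := 1 / 4)).tendsto 0 |>.comp hd'
  rw [ENNReal.zero_rpow_of_pos (by norm_num)] at this
  exact this.congr fun n => (tripleNorm_eq ((hu' n).sub hz).summable).symm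

end

/-! ### Minimizers of the truncated problems and competitors -/

theorem exists_minimizer {c : ℤ → ℝ} {C : ℝ} (hc : Tendsto c cofinite (𝓝 0))
    (hcC : ∀ k, |c k| ≤ C) (N : ℕ) : ∃ a ∈ DomJN N, ∀ z ∈ DomJN N, energy c a ≤ energy c z := by
  have hbdd : BddBelow (energy c '' DomJN N) := by
    refine ⟨-C ^ 2, ?_⟩
    rintro _ ⟨z, hz, rfl⟩
    exact neg_sq_le_energy hcC hz.1
  have hne : (energy c '' DomJN N).Nonempty := ⟨_, 0, zero_mem_domJN N, rfl⟩
  obtain ⟨e, -, he, hmem⟩ := exists_seq_tendsto_sInf hne hbdd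
  choose v hv hve using hmem
  have hinf : sInf (energy c '' DomJN N) < 1 :=
    (csInf_le hbdd ⟨0, zero_mem_domJN N, energy_zero c⟩).trans_lt one_pos
  obtain ⟨n₀, hn₀⟩ := eventually_atTop.1 (he.eventually (gt_mem_nhds hinf))
  -- The shift makes every energy at most 1, as the compactness lemmas require; the infimum is at
  -- most `energy c 0` = 0.
  set w : ℕ → ℤ → ℝ := fun n => v (n + n₀) with hw
  have hw1 : ∀ n, energy c (w n) ≤ 1 := fun n => by
    rw [hw, hve]
    exact (hn₀ _ (by lia)).le
  have hwD : ∀ n, w n ∈ DomJ := fun n => (hv _).1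
  obtain ⟨z, φ, hφ, hz⟩ := exists_subseq_tendsto (fun n => (mem_domJ_iff.1 (hwD n)).2.1)
    fun n => tsum_sq_le_of_energy_le_one hcC (hwD n) (hw1 n)
  have hlim : Tendsto (fun n => energy c (w (φ n))) atTop (𝓝 (sInf (energy c '' DomJN N))) := by
    have := ((tendsto_add_atTop_iff_nat n₀).2 he).comp hφ.tendsto_atTop
    exact this.congr fun n => (hve _).symm
  obtain ⟨hzD, hle⟩ := mem_domJ_and_energy_le hc hcC (fun n => hwD (φ n)) (fun n => hw1 (φ n)) hz hlim
  refine ⟨z, ⟨hzD, fun k hk => ?_⟩, fun y hy => hle.trans (csInf_le hbdd ⟨y, hy, rfl⟩)⟩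
  refine tendsto_nhds_unique (hz k) ?_
  simp only [hw, (hv _).2 k hk]
  exact tendsto_const_nhds

theorem exists_energy_neg {c : ℤ → ℝ} {k : ℕ} (hk : Odd k) (h1 : c k < 0) (h2 : c (-k) < 0) :
    ∃ z ∈ DomJN k, energy c z < 0 := by
  have hk0 : (k : ℤ) ≠ 0 := by exact_mod_cast hk.pos.ne'
  have hkk : (k : ℤ) ≠ -k := by omega
  set d : ℤ → ℝ := fun l => if l = k then 1 else if l = -k then -1 else 0 with hd
  have hd0 : ∀ l ∉ ({(k : ℤ), -(k : ℤ)} : Finset ℤ), d l = 0 := fun l hl => by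
    simp only [Finset.mem_insert, Finset.mem_singleton, not_or] at hl
    simp [hd, hl.1, hl.2]
  have hdsupp : ∀ l : ℤ, (k : ℤ) < |l| → d l = 0 := fun l hl => hd0 l fun hl' => by
    simp only [Finset.mem_insert, Finset.mem_singleton] at hl'
    rcases hl' with rfl | rfl <;> simp at hl
  have hdodd : IsOddSq d := by
    refine ⟨fun l => ?_, summable_of_ne_finset_zero fun l hl => by rw [hd0 l hl]; simp⟩
    simp only [hd]
    split_ifs <;> first | omega | simp
  have hdlin : lin c d = c k + c (-k) := by
    rw [lin, tsum_eq_sum fun l hl => by rw [hd0 l hl]; simp, Finset.sum_pair hkk]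
    simp [hd, hkk.symm]
  have hdfin : quartic d < ∞ := by
    rw [quartic_eq_sum hdsupp]
    exact ENNReal.ofReal_lt_top
  set Q := (quartic d).toReal
  have hQ : 0 ≤ Q := ENNReal.toReal_nonneg
  -- The energy of √s d is s(sQ/4 + lin c d), negative for this s because s(Q + 1) = -lin c d; the
  -- added 1 avoids division by zero.
  set s := -lin c d / (Q + 1) with hs
  have hs0 : 0 < s := div_pos (by rw [hdlin]; linarith) (by linarith)
  have hsQ : s * (Q + 1) = -lin c d := div_mul_cancel₀ _ (by linarith)
  refine ⟨√s • d, ⟨mem_domJ_iff.2 ⟨fun l hl => ?_, hdodd.smul _, ?_⟩, fun l hl => by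
    simp [hdsupp l hl]⟩, ?_⟩
  · have : d l = 0 := hd0 l fun hl' => by
      simp only [Finset.mem_insert, Finset.mem_singleton] at hl'
      have : Odd (k : ℤ) := by exact_mod_cast hk
      rcases hl' with rfl | rfl
      · exact Int.not_even_iff_odd.2 this hl
      · exact Int.not_even_iff_odd.2 this.neg hl
    simp [this]
  · rw [quartic_smul]
    exact ENNReal.mul_lt_top ENNReal.ofReal_lt_top hdfin
  · have hlin : lin c (√s • d) = s * lin c d := by
      rw [lin, lin, ← tsum_mul_left]
      congr 1
      funext l
      simp only [Pi.smul_apply, smul_eq_mul, mul_pow, Real.sq_sqrt hs0.le]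
      ring
    have hs4 : √s ^ 4 = s ^ 2 := by
      rw [show √s ^ 4 = (√s ^ 2) ^ 2 by ring, Real.sq_sqrt hs0.le]
    rw [energy, hlin, quartic_smul, hs4, ENNReal.toReal_mul, ENNReal.toReal_ofReal (sq_nonneg s)]
    change 1 / 4 * (s ^ 2 * Q) + s * lin c d < 0
    have : s * (1 / 4 * (s * Q) + lin c d) < 0 := mul_neg_of_pos_of_neg hs0 (by nlinarith)
    linarith

/-- Only an upper bound is needed: the quartic part does not increase and the quadratic part
converges. -/
theorem exists_energy_fejer_lt {c : ℤ → ℝ} {C : ℝ} (hc : Tendsto c cofinite (𝓝 0))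
    (hcC : ∀ k, |c k| ≤ C) {z : ℤ → ℝ} (hz : z ∈ DomJ) {b : ℝ} (hb : energy c z < b) :
    ∀ᶠ N in atTop, energy c (fejer N z) < b := by
  obtain ⟨-, h1, h2⟩ := mem_domJ_iff.1 hz
  have h3 := tendsto_lin hc hcC (fun N => h1.fejer N) (tendsto_fejer z) fun N =>
    (h1.fejer N).summable.tsum_le_tsum (fejer_sq_le N z) h1.summable
  have h4 := h3.const_add (1 / 4 * (quartic z).toReal)
  filter_upwards [h4.eventually (gt_mem_nhds hb)] with N hN
  refine lt_of_le_of_lt ?_ hN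
  rw [energy]
  have := ENNReal.toReal_mono h2.ne (quartic_fejer_le h1 N)
  gcongr

/-! ### The coefficients of the quadratic part: decay and sign -/

/-- The coefficients of the quadratic part of `J`, set to zero at even indices. -/
noncomputable def coeffJ (g : ℝ → ℝ) (ω γ : ℝ) (k : ℤ) : ℝ :=
  if Even k then 0 else
    (2 * Real.pi / ω) / (γ * ω ^ 4) * (PhiDeriv g ω k.natAbs / (k : ℝ) ^ 2)

theorem J_eq_energy {g : ℝ → ℝ} {ω γ : ℝ} {z : ℤ → ℝ} (hz : z ∈ DomJ) :
    J g ω γ z = energy (coeffJ g ω γ) z := by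
  obtain ⟨h0, h1, -⟩ := mem_domJ_iff.1 hz
  rw [J, energy, lin, conv_conv_zero h1.odd, ← tsum_mul_left]
  congr 2
  funext k
  by_cases hk : Even k
  · simp [h0 k hk]
  · rw [coeffJ, if_neg hk, mul_assoc]

theorem exists_coeffJ_bound {g : ℝ → ℝ} {ω γ C : ℝ}
    (hC : ∀ k : ℕ, Odd k → |PhiDeriv g ω k| ≤ C * k) :
    ∃ K, 0 ≤ K ∧ ∀ k : ℤ, |coeffJ g ω γ k| ≤ K * |(k : ℝ)|⁻¹ := by
  have hC0 : 0 ≤ C := by simpa using (abs_nonneg _).trans (hC 1 odd_one)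
  refine ⟨|(2 * Real.pi / ω) / (γ * ω ^ 4)| * C, by positivity, fun k => ?_⟩
  rw [coeffJ]
  split_ifs with hk
  · rw [abs_zero]; positivity
  · have hk' : Odd k.natAbs := Int.natAbs_odd.2 (Int.not_even_iff_odd.1 hk)
    have hk0 : (k : ℝ) ≠ 0 := by
      rintro h
      rw [Int.cast_eq_zero] at h
      exact hk (h ▸ Even.zero)
    rw [abs_mul, mul_assoc]
    refine mul_le_mul_of_nonneg_left ?_ (abs_nonneg _)
    rw [abs_div, abs_pow]
    have h1 := hC _ hk'
    rw [Nat.cast_natAbs, Int.cast_abs] at h1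
    have h2 : 0 < |(k : ℝ)| := abs_pos.2 hk0
    rw [div_le_iff₀ (by positivity)]
    calc _ ≤ C * |(k : ℝ)| := h1
      _ = _ := by field_simp

theorem tendsto_coeffJ {g : ℝ → ℝ} {ω γ K : ℝ}
    (hK : ∀ k : ℤ, |coeffJ g ω γ k| ≤ K * |(k : ℝ)|⁻¹) :
    Tendsto (coeffJ g ω γ) cofinite (𝓝 0) := by
  have h1 : Tendsto (fun k : ℤ => ‖(k : ℝ)‖) cofinite atTop :=
    (tendsto_norm_cocompact_atTop (E := ℝ)).comp Int.tendsto_coe_cofinite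
  have h2 : Tendsto (fun k : ℤ => K * |(k : ℝ)|⁻¹) cofinite (𝓝 (K * 0)) :=
    (tendsto_inv_atTop_zero.comp h1).const_mul K
  rw [mul_zero] at h2
  exact squeeze_zero_norm hK h2

theorem abs_coeffJ_le {g : ℝ → ℝ} {ω γ K : ℝ} (hK0 : 0 ≤ K)
    (hK : ∀ k : ℤ, |coeffJ g ω γ k| ≤ K * |(k : ℝ)|⁻¹) (k : ℤ) : |coeffJ g ω γ k| ≤ K := by
  refine (hK k).trans (mul_le_of_le_one_right hK0 ?_)
  rcases eq_or_ne k 0 with rfl | hk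
  · simp
  · refine inv_le_one_of_one_le₀ ?_
    exact_mod_cast Int.one_le_abs hk

theorem exists_coeffJ_neg {g : ℝ → ℝ} {ω γ : ℝ} (hω : 0 < ω)
    (hsign : (γ < 0 ∧ ∃ k : ℕ, Odd k ∧ 0 < PhiDeriv g ω k) ∨
      (0 < γ ∧ ∃ k : ℕ, Odd k ∧ PhiDeriv g ω k < 0)) :
    ∃ k : ℕ, Odd k ∧ coeffJ g ω γ k < 0 ∧ coeffJ g ω γ (-k) < 0 := by
  have key : ∀ k : ℕ, Odd k →
      (2 * Real.pi / ω) / (γ * ω ^ 4) * (PhiDeriv g ω k / (k : ℝ) ^ 2) < 0 →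
      coeffJ g ω γ k < 0 ∧ coeffJ g ω γ (-k) < 0 := fun k hk h => by
    have hk1 : ¬ Even (k : ℤ) := by
      rw [Int.even_coe_nat]
      exact Nat.not_even_iff_odd.2 hk
    have hk2 : ¬ Even (-(k : ℤ)) := by rwa [even_neg]
    rw [coeffJ, coeffJ, if_neg hk1, if_neg hk2]
    simpa using h
  have hT : 0 < 2 * Real.pi / ω := by positivity
  rcases hsign with ⟨hγ, k, hk, hP⟩ | ⟨hγ, k, hk, hP⟩
  · have hk0 : (0 : ℝ) < k := by exact_mod_cast hk.pos
    exact ⟨k, hk, key k hk (mul_neg_of_neg_of_pos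
      (div_neg_of_pos_of_neg hT (mul_neg_of_neg_of_pos hγ (by positivity))) (by positivity))⟩
  · have hk0 : (0 : ℝ) < k := by exact_mod_cast hk.pos
    exact ⟨k, hk, key k hk (mul_neg_of_pos_of_neg (by positivity)
      (div_neg_of_neg_of_pos hP (by positivity)))⟩

end Breather

theorem mainTheorem8 (g : ℝ → ℝ) (ω γ : ℝ) (hω : 0 < ω)
    (hC0 : Breather.CondC0 g γ) (hC1 : Breather.CondC1 g ω) (hC2 : Breather.CondC2 g ω)
    (hsign : (γ < 0 ∧ ∃ k : ℕ, Odd k ∧ 0 < Breather.PhiDeriv g ω k) ∨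
      (0 < γ ∧ ∃ k : ℕ, Odd k ∧ Breather.PhiDeriv g ω k < 0)) :
    ∃ m : ℝ, IsGLB (Breather.J g ω γ '' Breather.DomJ) m ∧
      (∃ N₀ : ℕ, ∀ N : ℕ, N₀ ≤ N → Odd N →
        ∃ a, Breather.IsMinimizerN g ω γ N a ∧ Breather.J g ω γ a < 0) ∧
      ∀ (N₀ : ℕ) (α : ℕ → ℤ → ℝ),
        (∀ N : ℕ, N₀ ≤ N → Odd N → Breather.IsMinimizerN g ω γ N (α N)) →
        Tendsto (fun N => Breather.J g ω γ (α N)) (atTop ⊓ 𝓟 {N : ℕ | Odd N}) (𝓝 m) ∧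
        ∃ s : ℕ → ℕ, StrictMono s ∧ (∀ n, Odd (s n)) ∧
          ∃ a ∈ Breather.DomJ,
            Tendsto (fun n => Breather.tripleNorm (α (s n) - a)) atTop (𝓝 0) ∧
            Breather.J g ω γ a = m := by
  open Breather in
  obtain ⟨B, -, hB⟩ := exists_phiDeriv_bound hC0 hC1 hC2
  obtain ⟨C, hC0', hC⟩ := exists_coeffJ_bound (γ := γ) hB
  have hc := tendsto_coeffJ hC
  have hcC := abs_coeffJ_le hC0' hC
  set c := coeffJ g ω γ with hcdef
  have hJ : ∀ {z}, z ∈ DomJ → J g ω γ z = energy c z := J_eq_energy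
  have hbdd : BddBelow (J g ω γ '' DomJ) := by
    refine ⟨-C ^ 2, ?_⟩
    rintro _ ⟨z, hz, rfl⟩
    rw [hJ hz]
    exact neg_sq_le_energy hcC hz
  have hglb : IsGLB (J g ω γ '' DomJ) (sInf (J g ω γ '' DomJ)) :=
    isGLB_csInf ⟨_, 0, zero_mem_domJ, rfl⟩ hbdd
  set m := sInf (J g ω γ '' DomJ)
  refine ⟨m, hglb, ?_, fun N₀ α hα => ?_⟩
  · obtain ⟨k, hk, hneg⟩ := exists_coeffJ_neg hω hsign
    obtain ⟨z, hz, hzneg⟩ := exists_energy_neg hk hneg.1 hneg.2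
    refine ⟨k, fun N hN _ => ?_⟩
    obtain ⟨a, ha, hmin⟩ := exists_minimizer hc hcC N
    have hzN : z ∈ DomJN N := ⟨hz.1, fun l hl => hz.2 l (by lia)⟩
    refine ⟨a, ⟨ha, fun y hy => ?_⟩, ?_⟩
    · rw [hJ ha.1, hJ hy.1]
      exact hmin y hy
    · rw [hJ ha.1]
      exact (hmin z hzN).trans_lt hzneg
  · have hlim : Tendsto (fun N => J g ω γ (α N)) (atTop ⊓ 𝓟 {N : ℕ | Odd N}) (𝓝 m) := by
      refine tendsto_order.2 ⟨fun b hb => ?_, fun b hb => ?_⟩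
      · rw [eventually_inf_principal]
        filter_upwards [eventually_ge_atTop N₀] with N hN hodd
        exact hb.trans_le (hglb.1 ⟨_, (hα N hN hodd).1.1, rfl⟩)
      -- The Fejér mean of a near-minimizer of J is admissible for J^(N), so it bounds the truncated
      -- minimum from above.
      · obtain ⟨_, ⟨z, hz, rfl⟩, hzb⟩ := (isGLB_lt_iff hglb).1 hb
        rw [hJ hz] at hzb
        rw [eventually_inf_principal]
        filter_upwards [eventually_ge_atTop N₀, exists_energy_fejer_lt hc hcC hz hzb]
          with N hN hlt hodd
        refine ((hα N hN hodd).2 _ (fejer_mem_domJN hz N)).trans_lt ?_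
        rwa [hJ (fejer_mem_domJN hz N).1]
    refine ⟨hlim, ?_⟩
    -- These indices are odd and at least N₀, so the minimizing property holds for every n.
    have hodd : ∀ n, Odd (2 * (n + N₀) + 1) := fun n => odd_two_mul_add_one _
    have hmin := fun n => hα (2 * (n + N₀) + 1) (by lia) (hodd n)
    have hle : ∀ n, energy c (α (2 * (n + N₀) + 1)) ≤ 1 := fun n => by
      have := (hmin n).2 0 (zero_mem_domJN _)
      rw [hJ (hmin n).1.1, hJ zero_mem_domJ, energy_zero] at this
      exact this.trans zero_le_one
    obtain ⟨a, φ, hφ, ha⟩ := exists_subseq_tendsto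
      (fun n => (mem_domJ_iff.1 (hmin n).1.1).2.1)
      fun n => tsum_sq_le_of_energy_le_one hcC (hmin n).1.1 (hle n)
    have hs : StrictMono fun n => 2 * (φ n + N₀) + 1 := fun i j hij => by
      have := hφ hij
      simp only
      lia
    have hlim' : Tendsto (fun n => energy c (α (2 * (φ n + N₀) + 1))) atTop (𝓝 m) := by
      have h1 : Tendsto (fun n => 2 * (φ n + N₀) + 1) atTop (atTop ⊓ 𝓟 {N : ℕ | Odd N}) :=
        tendsto_inf.2 ⟨hs.tendsto_atTop, tendsto_principal.2 (Eventually.of_forall fun n => hodd _)⟩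
      exact (hlim.comp h1).congr fun n => hJ (hmin (φ n)).1.1
    obtain ⟨haD, hale⟩ := mem_domJ_and_energy_le hc hcC (fun n => (hmin (φ n)).1.1)
      (fun n => hle (φ n)) ha hlim'
    have ham : energy c a = m := hale.antisymm (by rw [← hJ haD]; exact hglb.1 ⟨a, haD, rfl⟩)
    refine ⟨_, hs, fun n => hodd _, a, haD, ?_, (hJ haD).trans ham⟩
    exact tendsto_tripleNorm_sub hc hcC (fun n => (hmin (φ n)).1.1) (fun n => hle (φ n)) ha haD
      (ham ▸ hlim')
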